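/- Let $\mathbb L^4$ be $\mathbb R^4$ with the Lorentzian metric $\langle x,y\rangle=-x_0y_0+x_1y_1+x_2y_2+x_3y_3$, let $\Lambda^+=\{v\in\mathbb L^4:\langle v,v\rangle=0,\ v_0>0\}$ be the future lightcone, and let $\partial_0=(1,0,0,0)$. A smooth ($C^\infty$) map $\psi$ from a surface $M$ to $\mathbb L^4$ is a spacelike immersion if the induced metric $\psi^*\langle\,,\rangle$ is positive definite; let $\nabla f$ denote the gradient of a function $f$ with respect to this metric and $K$ its Gauss curvature. The second fundamental form $\mathrm{II}$ is the normal component of the second derivative of $\psi$, the shape operator $A_\xi$ of a normal vector $\xi$ is given by $\langle A_\xi X,Y\rangle=\langle \mathrm{II}(X,Y),\xi\rangle$, and $\psi$ is totally umbilical if at every point each $A_\xi$, $\xi$ normal, is a multiple of the identity $I$. For a spacelike immersion $\psi$ with $\psi(M)\subset\Lambda^+$ and first component $\psi_0$, put $$\eta=\frac{1+\|\nabla\psi_0\|^2}{2\psi_0^2}\,\psi-\frac1{\psi_0}\bigl(\partial_0+\psi_*(\nabla\psi_0)\bigr).$$ For $u\in\mathbb L^4$ with $\langle u,u\rangle=-1$,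 $u_0<0$, and for $r>0$, put $$\mathbb S^2(u,r)=\{x\in\mathbb L^4:\langle x,x\rangle=0,\ \langle u,x\rangle=r\}.$$ (1) For all such $u$ and $r$, one has $\mathbb S^2(u,r)\subset\Lambda^+$. Let $\phi:\mathbb S^2\to\Lambda^+$, $\phi(x,y,z)=(1,x,y,z)$. Then $\langle u,\phi\rangle>0$ on $\mathbb S^2$ and, with $\sigma=\log r-\log\langle u,\phi\rangle$, the map $\psi_\sigma=e^\sigma\phi:\mathbb S^2\to\mathbb L^4$ is a spacelike immersion and a topological embedding with image $\mathbb S^2(u,r)$. Its field $\eta_\sigma=\eta$ is normal and lightlike with $\langle\psi_\sigma,\eta_\sigma\rangle=1$; moreover $A_{\eta_\sigma}=-\frac1{2r^2}I$, the Gauss curvature is $K_\sigma=\frac1{r^2}$, and $\psi_\sigma$ is totally umbilical. (2) Conversely, let $\psi:\mathbb S^2\to\mathbb L^4$ be a totally umbilical spacelike immersion with $\psi(\mathbb S^2)\subset\Lambda^+$. Then $\eta$ is normal and lightlike with $\langle\psi,\eta\rangle=1$, and there is $r>0$ such that $K=\frac1{r^2}$ and $A_\eta=-\frac1{2r^2}I$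 at every point, the field $w=-\frac1{2r^2}\psi+\eta$ is a constant timelike vector of $\mathbb L^4$, and $u=rw$ satisfies $\langle u,u\rangle=-1$, $u_0<0$ and $\psi(\mathbb S^2)=\mathbb S^2(u,r)$. -/

import Mathlib

open scoped Manifold ContDiff

noncomputable section

namespace LightCone

/-- The underlying vector space of Lorentz-Minkowski spacetime. -/
abbrev L4 : Type := Fin 4 → ℝ

/-- The Lorentzian metric `-dx₀² + dx₁² + dx₂² + dx₃²`. -/
def lor (x y : L4) : ℝ := -(x 0 * y 0) + x 1 * y 1 + x 2 * y 2 + x 3 * y 3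

/-- The coordinate vector `∂₀`. -/
def e0 : L4 := ![1, 0, 0, 0]

/-- The future lightcone with vertex at the origin. -/
def futureCone : Set L4 := {v | lor v v = 0 ∧ 0 < v 0}

/-- The set of `x` with `⟨x, x⟩ = 0` and `⟨u, x⟩ = r`. -/
def S2 (u : L4) (r : ℝ) : Set L4 := {x | lor x x = 0 ∧ lor u x = r}

/-- The coordinate plane, the model space of surfaces. -/
abbrev Plane : Type := EuclideanSpace ℝ (Fin 2)

/-- The unit sphere, with Mathlib's smooth structure given by stereographic charts. -/
abbrev Sph : Type := Metric.sphere (0 : EuclideanSpace ℝ (Fin 3)) 1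

/-- The partial derivative of `f` in the `i`-th coordinate direction. -/
def pd {F : Type*} [NormedAddCommGroup F] [NormedSpace ℝ F] (i : Fin 2) (f : Plane → F)
    (x : Plane) : F :=
  fderiv ℝ f x (EuclideanSpace.single i (1 : ℝ))

section Intrinsic

/-- Christoffel symbol `Γᵏᵢⱼ` of the metric with coefficient matrix `G`. -/
def christoffel (G : Plane → Matrix (Fin 2) (Fin 2) ℝ) (k i j : Fin 2) (x : Plane) : ℝ :=
  (1 / 2) * ∑ l, (G x)⁻¹ k l *
    (pd i (fun y => G y j l) x + pd j (fun y => G y i l) x - pd l (fun y => G y i j) x)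

/-- The `l`-th component of `R(∂ᵢ, ∂ⱼ)∂ₖ`, where
`R(X, Y)Z = ∇_X ∇_Y Z - ∇_Y ∇_X Z - ∇_[X,Y] Z`. -/
def riemann (G : Plane → Matrix (Fin 2) (Fin 2) ℝ) (l i j k : Fin 2) (x : Plane) : ℝ :=
  pd i (christoffel G l j k) x - pd j (christoffel G l i k) x
    + ∑ m, (christoffel G l i m x * christoffel G m j k x
      - christoffel G l j m x * christoffel G m i k x)

/-- Gauss curvature `⟨R(∂₁, ∂₂)∂₂, ∂₁⟩ / det G` of the metric with coefficient matrix `G`. -/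
def gaussOfMetric (G : Plane → Matrix (Fin 2) (Fin 2) ℝ) (x : Plane) : ℝ :=
  (∑ l, G x 0 l * riemann G l 0 1 1 x) / (G x).det

end Intrinsic

section Extrinsic

variable {M : Type*} [TopologicalSpace M] [ChartedSpace Plane M]

/-- A smooth map whose induced metric is positive definite (so that its differential is injective
at every point and it is an immersion). -/
def IsSpacelikeImmersion (ψ : M → L4) : Prop :=
  ContMDiff (𝓡 2) 𝓘(ℝ, L4) ∞ ψ ∧
    ∀ (p : M) (v : TangentSpace (𝓡 2) p), v ≠ 0 →
      0 < lor (mfderiv (𝓡 2) 𝓘(ℝ, L4) ψ p v) (mfderiv (𝓡 2) 𝓘(ℝ, L4) ψ p v)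

/-- `ξ` is normal to the surface `ψ` at `p`. -/
def IsNormalAt (ψ : M → L4) (p : M) (ξ : L4) : Prop :=
  ∀ v : TangentSpace (𝓡 2) p, lor ξ (mfderiv (𝓡 2) 𝓘(ℝ, L4) ψ p v) = 0

/-- The map `ψ` written in the preferred chart around `p`. -/
def loc (ψ : M → L4) (p : M) : Plane → L4 := ψ ∘ (extChartAt (𝓡 2) p).symm

/-- The coordinates of `p` in the preferred chart around `p`. -/
def pt (p : M) : Plane := extChartAt (𝓡 2) p p

/-- Coefficients of the metric induced by `ψ`, in the preferred chart around `p`. -/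
def metricCoeff (ψ : M → L4) (p : M) (x : Plane) : Matrix (Fin 2) (Fin 2) ℝ :=
  Matrix.of fun i j => lor (pd i (loc ψ p) x) (pd j (loc ψ p) x)

/-- Gauss curvature at `p` of the metric induced by `ψ`. -/
def gaussCurvature (ψ : M → L4) (p : M) : ℝ := gaussOfMetric (metricCoeff ψ p) (pt p)

/-- The component of `v` tangent to the surface `ψ` at `p`. -/
def tangentPart (ψ : M → L4) (p : M) (v : L4) : L4 :=
  ∑ i, ∑ j, ((metricCoeff ψ p (pt p))⁻¹ i j * lor v (pd j (loc ψ p) (pt p))) •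
    pd i (loc ψ p) (pt p)

/-- The second fundamental form `II(∂ᵢ, ∂ⱼ)` of `ψ` at `p`: the normal component of the second
derivative, in the preferred chart around `p`. -/
def secondFF (ψ : M → L4) (p : M) (i j : Fin 2) : L4 :=
  pd i (pd j (loc ψ p)) (pt p) - tangentPart ψ p (pd i (pd j (loc ψ p)) (pt p))

/-- The matrix, in the coordinate basis at `p`, of the shape operator `A_ξ` given by
`⟨A_ξ X, Y⟩ = ⟨II(X, Y), ξ⟩`. -/
def shapeOp (ψ : M → L4) (p : M) (ξ : L4) : Matrix (Fin 2) (Fin 2) ℝ :=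
  (metricCoeff ψ p (pt p))⁻¹ * Matrix.of fun i j => lor (secondFF ψ p i j) ξ

/-- Every shape operator is a multiple of the identity. -/
def IsTotallyUmbilical (ψ : M → L4) : Prop :=
  ∀ (p : M) (ξ : L4), IsNormalAt ψ p ξ → ∃ c : ℝ, shapeOp ψ p ξ = c • (1 : Matrix _ _ ℝ)

/-- Components at `p`, in the coordinate basis, of the gradient of `f` with respect to the metric
induced by `ψ`. -/
def gradient (ψ : M → L4) (f : M → ℝ) (p : M) (i : Fin 2) : ℝ :=
  ∑ j, (metricCoeff ψ p (pt p))⁻¹ i j * pd j (f ∘ (extChartAt (𝓡 2) p).symm) (pt p)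

/-- `‖∇f‖²` at `p`, with respect to the metric induced by `ψ`. -/
def gradientNormSq (ψ : M → L4) (f : M → ℝ) (p : M) : ℝ :=
  ∑ i, ∑ j, metricCoeff ψ p (pt p) i j * gradient ψ f p i * gradient ψ f p j

/-- The field `η = (1 + ‖∇ψ₀‖²) / (2 ψ₀²) ψ - (1 / ψ₀) (∂₀ + ψ_*(∇ψ₀))` along a surface `ψ` in the
future lightcone, where `ψ₀` is the first component of `ψ`. -/
def etaField (ψ : M → L4) (p : M) : L4 :=
  ((1 + gradientNormSq ψ (fun q => ψ q 0) p) / (2 * (ψ p 0) ^ 2)) • ψ p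
    - (1 / ψ p 0) •
      (e0 + ∑ i, gradient ψ (fun q => ψ q 0) p i • pd i (loc ψ p) (pt p))

/-- `η` is a lightlike normal field along `ψ` with `⟨ψ, η⟩ = 1`. -/
def IsConjugateNullNormal (ψ η : M → L4) : Prop :=
  ∀ p, IsNormalAt ψ p (η p) ∧ lor (η p) (η p) = 0 ∧ lor (ψ p) (η p) = 1

end Extrinsic

/-- The standard embedding `(x, y, z) ↦ (1, x, y, z)` of the unit sphere in the lightcone. -/
def stdEmb (x : Sph) : L4 := ![1, x.1 0, x.1 1, x.1 2]

/-- The map `e^σ ψ`, where `ψ` is the standard embedding and `σ = log r - log ⟨u, ψ⟩`. -/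
def roundParam (u : L4) (r : ℝ) (x : Sph) : L4 :=
  Real.exp (Real.log r - Real.log (lor u (stdEmb x))) • stdEmb x

end LightCone

end

/-! Along a spacelike surface in the cone the normal plane is Lorentzian, with null basis `ψ`, `η`
normalised by `⟨ψ, η⟩ = 1`; so `η` is the only null normal with that product, whatever chart
computes it. Differentiating `⟨ψ, ψ⟩ = 0` twice gives `⟨ψ, ∂ᵢ∂ⱼψ⟩ = -gᵢⱼ`, that is `A_ψ = -I`.
Umbilicity is therefore a condition on `A_η` alone, and if `A_η = c I` the Gauss equation yields `K
= -2c`.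

On a section `⟨u, ψ⟩ = r` the vector `u` is normal, so uniqueness forces `η = u / r + ψ / (2r²)`.
Since `u` is also orthogonal to all second derivatives, `c = -1 / (2r²)`.

Conversely, umbilicity gives the Weingarten equation `dη = -c dψ`. Symmetry of the mixed derivatives
of `η` makes `c` constant (`principalCurvature_const`), hence `w = cψ + η` is constant, with `⟨w, w⟩
= 2c` and `⟨w, ψ⟩ = 1`. Compactness enters twice, through a maximum of a linear function `⟨y, ψ⟩`,
where `y` is normal. The choice `y = -∂₀` gives `c < 0` (`principalCurvature_neg`); taking for `y` a
point of the section shows that `y` is itself a value of `ψ` (`S2_subset_range`), without any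
covering or degree argument. -/

noncomputable section

namespace LightCone

/-! ### Lorentzian linear algebra: null frames and causal inequalities -/

section Algebra

theorem lor_comm (x y : L4) : lor x y = lor y x := by
  unfold lor; ring

@[simp] theorem lor_add_left (x y z : L4) : lor (x + y) z = lor x z + lor y z := by
  simp [lor]; ring

@[simp] theorem lor_add_right (x y z : L4) : lor x (y + z) = lor x y + lor x z := by
  simp [lor]; ring

@[simp] theorem lor_sub_left (x y z : L4) : lor (x - y) z = lor x z - lor y z := by
  simp [lor]; ring

@[simp] theorem lor_sub_right (x y z : L4) : lor x (y - z) = lor x y - lor x z := by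
  simp [lor]; ring

@[simp] theorem lor_smul_left (c : ℝ) (x y : L4) : lor (c • x) y = c * lor x y := by
  simp [lor]; ring

@[simp] theorem lor_smul_right (c : ℝ) (x y : L4) : lor x (c • y) = c * lor x y := by
  simp [lor]; ring

@[simp] theorem lor_zero_left (y : L4) : lor 0 y = 0 := by simp [lor]

@[simp] theorem lor_zero_right (y : L4) : lor y 0 = 0 := by simp [lor]

theorem lor_e0_left (y : L4) : lor e0 y = -y 0 := by simp [lor, e0]

/-- A vector orthogonal to everything vanishes. -/
theorem eq_zero_of_lor_eq_zero {v : L4} (h : ∀ x, lor v x = 0) : v = 0 := by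
  ext k
  fin_cases k
  · simpa [lor] using h (Pi.single 0 1)
  · simpa [lor] using h (Pi.single 1 1)
  · simpa [lor] using h (Pi.single 2 1)
  · simpa [lor] using h (Pi.single 3 1)

/-- `F`, `E` is a null basis, normalised by `⟨F, E⟩ = 1`, of the orthogonal complement of the
nondegenerate plane spanned by `t 0` and `t 1`. -/
structure IsNullFrame (F E : L4) (t : Fin 2 → L4) : Prop where
  FF : lor F F = 0
  EE : lor E E = 0
  FE : lor F E = 1
  Ft : ∀ i, lor F (t i) = 0
  Et : ∀ i, lor E (t i) = 0
  gram : lor (t 0) (t 0) * lor (t 1) (t 1) - lor (t 0) (t 1) ^ 2 ≠ 0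

namespace IsNullFrame

variable {F E : L4} {t : Fin 2 → L4}

theorem linearIndependent (h : IsNullFrame F E t) : LinearIndependent ℝ ![F, E, t 0, t 1] := by
  rw [Fintype.linearIndependent_iff]
  intro c hc
  simp only [Fin.sum_univ_four, Matrix.cons_val_zero, Matrix.cons_val_one, Matrix.cons_val] at hc
  have hF := congrArg (lor F) hc
  have hE := congrArg (lor E) hc
  have ha := congrArg (lor (t 0)) hc
  have hb := congrArg (lor (t 1)) hc
  simp only [lor_add_right, lor_smul_right, lor_zero_right, h.FF, h.EE, h.FE, h.Ft, h.Et,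
    lor_comm E F, lor_comm (t _) F, lor_comm (t _) E, lor_comm (t 1) (t 0)] at hF hE ha hb
  have h2 : c 2 = 0 := by
    refine (mul_eq_zero.1 ?_).resolve_right h.gram
    linear_combination lor (t 1) (t 1) * ha - lor (t 0) (t 1) * hb
  have h3 : c 3 = 0 := by
    refine (mul_eq_zero.1 ?_).resolve_right h.gram
    linear_combination lor (t 0) (t 0) * hb - lor (t 0) (t 1) * ha
  intro i
  fin_cases i
  · simpa using hE
  · simpa using hF
  · simpa using h2
  · simpa using h3

/-- The four frame vectors span spacetime and the form is nondegenerate. Vector identities below are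
proved by testing against the frame. -/
theorem eq_zero (h : IsNullFrame F E t) {v : L4} (hF : lor v F = 0) (hE : lor v E = 0)
    (ht : ∀ i, lor v (t i) = 0) : v = 0 := by
  have hs : Submodule.span ℝ (Set.range ![F, E, t 0, t 1]) = ⊤ :=
    h.linearIndependent.span_eq_top_of_card_eq_finrank' (by simp)
  apply eq_zero_of_lor_eq_zero
  intro x
  have hx : x ∈ Submodule.span ℝ (Set.range ![F, E, t 0, t 1]) := hs ▸ Submodule.mem_top
  induction hx using Submodule.span_induction with
  | mem y hy =>
    obtain ⟨i, rfl⟩ := hy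
    fin_cases i
    · simpa using hF
    · simpa using hE
    · simpa using ht 0
    · simpa using ht 1
  | zero => simp
  | add y z _ _ hy hz => simp [hy, hz]
  | smul c y _ hy => simp [hy]

/-- Decomposition of a normal vector in the null frame. -/
theorem normal_eq (h : IsNullFrame F E t) {v : L4} (ht : ∀ i, lor v (t i) = 0) :
    v = lor v E • F + lor v F • E := by
  rw [← sub_eq_zero]
  apply h.eq_zero
  · simp [h.FF, h.FE, lor_comm E F]
  · simp [h.EE, h.FE]
  · intro i
    simp [ht, h.Ft, h.Et]

/-- The conjugate null normal is unique. -/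
theorem unique (h : IsNullFrame F E t) {v : L4} (ht : ∀ i, lor v (t i) = 0)
    (hv : lor v v = 0) (hF : lor F v = 1) : v = E := by
  have key := h.normal_eq ht
  rw [lor_comm v F, hF, one_smul] at key
  have : lor v E = 0 := by
    have h2 := hv
    rw [key] at h2
    simp only [lor_add_left, lor_add_right, lor_smul_left, lor_smul_right, h.FF, h.EE, h.FE,
      lor_comm E F] at h2
    linarith
  rw [key, this]
  simp

end IsNullFrame

/-- Cauchy-Schwarz for the spatial parts: by Lagrange's identity the difference is a sum of three
squared minors. -/
theorem inner_sq_le (x y : L4) : (x 1 * y 1 + x 2 * y 2 + x 3 * y 3) ^ 2 ≤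
    (x 1 ^ 2 + x 2 ^ 2 + x 3 ^ 2) * (y 1 ^ 2 + y 2 ^ 2 + y 3 ^ 2) := by
  nlinarith [sq_nonneg (x 1 * y 2 - x 2 * y 1), sq_nonneg (x 1 * y 3 - x 3 * y 1),
    sq_nonneg (x 2 * y 3 - x 3 * y 2)]

theorem lor_nonpos_of_futureCone {x y : L4} (hx : x ∈ futureCone) (hy : y ∈ futureCone) :
    lor x y ≤ 0 := by
  obtain ⟨hx, hx0⟩ := hx
  obtain ⟨hy, hy0⟩ := hy
  have h := inner_sq_le x y
  unfold lor at *
  have h1 : x 1 ^ 2 + x 2 ^ 2 + x 3 ^ 2 = x 0 ^ 2 := by linarith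
  have h2 : y 1 ^ 2 + y 2 ^ 2 + y 3 ^ 2 = y 0 ^ 2 := by linarith
  rw [h1, h2, ← mul_pow] at h
  have := abs_le_of_sq_le_sq h (by positivity)
  linarith [(abs_le.1 this).2]

/-- Orthogonal vectors of the future cone are proportional. -/
theorem eq_smul_of_futureCone {x y : L4} (hx : x ∈ futureCone) (hy : y ∈ futureCone)
    (h : lor x y = 0) : y = (y 0 / x 0) • x := by
  obtain ⟨hx, hx0⟩ := hx
  obtain ⟨hy, hy0⟩ := hy
  unfold lor at *
  have hs : (x 0 * y 1 - y 0 * x 1) ^ 2 + (x 0 * y 2 - y 0 * x 2) ^ 2 +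
      (x 0 * y 3 - y 0 * x 3) ^ 2 = 0 := by
    linear_combination x 0 ^ 2 * hy + y 0 ^ 2 * hx - 2 * x 0 * y 0 * h
  have h1 : x 0 * y 1 - y 0 * x 1 = 0 := by
    apply pow_eq_zero_iff two_ne_zero |>.1; nlinarith [sq_nonneg (x 0 * y 1 - y 0 * x 1),
      sq_nonneg (x 0 * y 2 - y 0 * x 2), sq_nonneg (x 0 * y 3 - y 0 * x 3)]
  have h2 : x 0 * y 2 - y 0 * x 2 = 0 := by
    apply pow_eq_zero_iff two_ne_zero |>.1; nlinarith [sq_nonneg (x 0 * y 1 - y 0 * x 1),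
      sq_nonneg (x 0 * y 2 - y 0 * x 2), sq_nonneg (x 0 * y 3 - y 0 * x 3)]
  have h3 : x 0 * y 3 - y 0 * x 3 = 0 := by
    apply pow_eq_zero_iff two_ne_zero |>.1; nlinarith [sq_nonneg (x 0 * y 1 - y 0 * x 1),
      sq_nonneg (x 0 * y 2 - y 0 * x 2), sq_nonneg (x 0 * y 3 - y 0 * x 3)]
  ext k
  have := hx0.ne'
  fin_cases k <;> simp <;> field_simp <;> linarith

/-- For a timelike `w` and a future null `x`, the product `⟨w, x⟩` is positive only if `w` is
past-pointing. -/
theorem neg_of_lor_pos {w x : L4} (hw : lor w w < 0) (hx : x ∈ futureCone) (h : 0 < lor w x) :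
    w 0 < 0 := by
  obtain ⟨hx, hx0⟩ := hx
  by_contra! hw0
  have h0 := inner_sq_le w x
  unfold lor at *
  have h1 : w 1 ^ 2 + w 2 ^ 2 + w 3 ^ 2 ≤ w 0 ^ 2 := by linarith
  have h2 : x 1 ^ 2 + x 2 ^ 2 + x 3 ^ 2 = x 0 ^ 2 := by linarith
  rw [h2] at h0
  have h3 : (w 1 * x 1 + w 2 * x 2 + w 3 * x 3) ^ 2 ≤ (w 0 * x 0) ^ 2 := by
    rw [mul_pow]; exact h0.trans (by gcongr)
  have := abs_le_of_sq_le_sq h3 (by positivity)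
  linarith [(abs_le.1 this).2]

theorem lor_pos_of_past {u x : L4} (hu : lor u u = -1) (hu0 : u 0 < 0) (hx : x ∈ futureCone) :
    0 < lor u x := by
  obtain ⟨hx, hx0⟩ := hx
  have h0 := inner_sq_le u x
  unfold lor at *
  have h1 : u 1 ^ 2 + u 2 ^ 2 + u 3 ^ 2 = u 0 ^ 2 - 1 := by linarith
  have h2 : x 1 ^ 2 + x 2 ^ 2 + x 3 ^ 2 = x 0 ^ 2 := by linarith
  rw [h1, h2] at h0
  have h3 : (u 1 * x 1 + u 2 * x 2 + u 3 * x 3) ^ 2 < (-u 0 * x 0) ^ 2 := by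
    nlinarith [sq_pos_of_pos hx0]
  have := abs_lt_of_sq_lt_sq h3 (by nlinarith)
  linarith [(abs_lt.1 this).1]

/-- Since `u` is past-pointing, a null `x` with `x 0 ≤ 0` would give `⟨u, x⟩ ≤ 0`; this also
excludes `x = 0`. -/
theorem S2_subset_futureCone {u : L4} {r : ℝ} (hu : lor u u = -1) (hu0 : u 0 < 0) (hr : 0 < r) :
    S2 u r ⊆ futureCone := by
  rintro x ⟨hx, hux⟩
  refine ⟨hx, ?_⟩
  by_contra! hx0
  have h0 := inner_sq_le u x
  unfold lor at *
  have h1 : u 1 ^ 2 + u 2 ^ 2 + u 3 ^ 2 ≤ u 0 ^ 2 := by linarith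
  have h2 : x 1 ^ 2 + x 2 ^ 2 + x 3 ^ 2 = x 0 ^ 2 := by linarith
  rw [h2] at h0
  have h3 : (u 1 * x 1 + u 2 * x 2 + u 3 * x 3) ^ 2 ≤ (u 0 * x 0) ^ 2 := by
    rw [mul_pow]; exact h0.trans (by gcongr)
  have := abs_le_of_sq_le_sq h3 (by nlinarith)
  linarith [(abs_le.1 this).2]

end Algebra

/-! ### Partial derivatives in the coordinate plane -/

section Calculus

theorem _root_.ContDiff.lor {n : WithTop ℕ∞} {F : Type*} [NormedAddCommGroup F] [NormedSpace ℝ F]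
    {f g : F → L4} (hf : ContDiff ℝ n f) (hg : ContDiff ℝ n g) :
    ContDiff ℝ n fun x => lor (f x) (g x) := by
  unfold LightCone.lor
  rw [contDiff_pi] at hf hg
  exact ((((hf 0).mul (hg 0)).neg.add ((hf 1).mul (hg 1))).add ((hf 2).mul (hg 2))).add
    ((hf 3).mul (hg 3))

theorem pd_apply {f : Plane → L4} {x : Plane} (hf : DifferentiableAt ℝ f x) (i : Fin 2)
    (k : Fin 4) : pd i (fun y => f y k) x = pd i f x k := by
  have := (hasFDerivAt_pi'.1 hf.hasFDerivAt) k
  simp [pd, this.fderiv]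

theorem pd_mul {f g : Plane → ℝ} {x : Plane} (hf : DifferentiableAt ℝ f x)
    (hg : DifferentiableAt ℝ g x) (i : Fin 2) :
    pd i (fun y => f y * g y) x = pd i f x * g x + f x * pd i g x := by
  simp [pd, fderiv_fun_mul hf hg]
  ring

theorem pd_smul {f : Plane → ℝ} {g : Plane → L4} {x : Plane} (hf : DifferentiableAt ℝ f x)
    (hg : DifferentiableAt ℝ g x) (i : Fin 2) :
    pd i (fun y => f y • g y) x = pd i f x • g x + f x • pd i g x := by
  simp [pd, fderiv_fun_smul hf hg]
  abel

theorem pd_add {E : Type*} [NormedAddCommGroup E] [NormedSpace ℝ E] {f g : Plane → E} {x : Plane}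
    (hf : DifferentiableAt ℝ f x) (hg : DifferentiableAt ℝ g x) (i : Fin 2) :
    pd i (fun y => f y + g y) x = pd i f x + pd i g x := by
  simp [pd, fderiv_fun_add hf hg]

theorem pd_neg {E : Type*} [NormedAddCommGroup E] [NormedSpace ℝ E] {f : Plane → E} {x : Plane}
    (i : Fin 2) : pd i (fun y => -f y) x = -pd i f x := by
  simp [pd, fderiv_fun_neg]

theorem pd_const {E : Type*} [NormedAddCommGroup E] [NormedSpace ℝ E] (c : E) (x : Plane)
    (i : Fin 2) : pd i (fun _ => c) x = 0 := by
  simp [pd]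

theorem pd_lor {f g : Plane → L4} {x : Plane} (hf : DifferentiableAt ℝ f x)
    (hg : DifferentiableAt ℝ g x) (i : Fin 2) :
    pd i (fun y => lor (f y) (g y)) x = lor (pd i f x) (g x) + lor (f x) (pd i g x) := by
  have hf' := differentiableAt_pi.1 hf
  have hg' := differentiableAt_pi.1 hg
  unfold lor
  rw [pd_add (by fun_prop) (by fun_prop), pd_add (by fun_prop) (by fun_prop),
    pd_add (by fun_prop) (by fun_prop), pd_neg, pd_mul (hf' 0) (hg' 0), pd_mul (hf' 1) (hg' 1),
    pd_mul (hf' 2) (hg' 2), pd_mul (hf' 3) (hg' 3)]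
  simp only [pd_apply hf, pd_apply hg]
  ring

theorem _root_.ContDiff.pd {E : Type*} [NormedAddCommGroup E] [NormedSpace ℝ E] {f : Plane → E}
    (hf : ContDiff ℝ ∞ f) (i : Fin 2) : ContDiff ℝ ∞ (pd i f) :=
  (hf.fderiv_right (m := ∞) (by simp)).clm_apply contDiff_const

theorem _root_.ContDiff.diffAt {E : Type*} [NormedAddCommGroup E] [NormedSpace ℝ E] {f : Plane → E}
    (hf : ContDiff ℝ ∞ f) (x : Plane) : DifferentiableAt ℝ f x :=
  (hf.differentiable (by simp)) x

theorem pd_comm {E : Type*} [NormedAddCommGroup E] [NormedSpace ℝ E] {f : Plane → E}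
    (hf : ContDiff ℝ ∞ f) (i j : Fin 2) (x : Plane) : pd i (pd j f) x = pd j (pd i f) x := by
  have hd : DifferentiableAt ℝ (fderiv ℝ f) x :=
    (hf.fderiv_right (m := ∞) (by simp)).diffAt x
  have h : ∀ i j, pd i (pd j f) x =
      fderiv ℝ (fderiv ℝ f) x (EuclideanSpace.single i 1) (EuclideanSpace.single j 1) := by
    intro i j
    have := (hd.hasFDerivAt.clm_apply (hasFDerivAt_const (EuclideanSpace.single j (1 : ℝ)) x)).fderiv
    unfold pd
    rw [this]
    simp
  rw [h, h]
  exact (hf.contDiffAt.isSymmSndFDerivAt (by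
    simpa using WithTop.coe_le_coe.2 (le_top : (2 : ℕ∞) ≤ ⊤))) _ _

theorem eq_sum_single (v : Plane) : v = ∑ i, v i • EuclideanSpace.single i (1 : ℝ) := by
  ext k
  fin_cases k <;> simp

theorem fderiv_eq_sum_pd {E : Type*} [NormedAddCommGroup E] [NormedSpace ℝ E] (f : Plane → E)
    (x v : Plane) : fderiv ℝ f x v = ∑ i, v i • pd i f x := by
  conv_lhs => rw [eq_sum_single v]
  simp [pd]

end Calculus

/-! ### Induced metric, Christoffel symbols and the Gauss equation -/

section LocalMetric

/-- Coefficients of the metric induced by a parametrised surface. -/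
def metricLoc (F : Plane → L4) (x : Plane) : Matrix (Fin 2) (Fin 2) ℝ :=
  Matrix.of fun i j => lor (pd i F x) (pd j F x)

variable {F : Plane → L4}

theorem metricLoc_apply (x : Plane) (i j : Fin 2) :
    metricLoc F x i j = lor (pd i F x) (pd j F x) := rfl

theorem metricLoc_comm (x : Plane) (i j : Fin 2) : metricLoc F x i j = metricLoc F x j i :=
  lor_comm _ _

theorem contDiff_metricLoc (hF : ContDiff ℝ ∞ F) (i j : Fin 2) :
    ContDiff ℝ ∞ fun x => metricLoc F x i j :=
  (hF.pd i).lor (hF.pd j)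

theorem contDiff_metricLoc_inv (hF : ContDiff ℝ ∞ F) (hG : ∀ x, (metricLoc F x).det ≠ 0)
    (i j : Fin 2) : ContDiff ℝ ∞ fun x => (metricLoc F x)⁻¹ i j := by
  have h := contDiff_metricLoc hF
  have hdet : ContDiff ℝ ∞ fun x => ((metricLoc F x).det)⁻¹ := by
    refine ContDiff.inv ?_ hG
    simp only [Matrix.det_fin_two]
    exact ((h 0 0).mul (h 1 1)).sub ((h 0 1).mul (h 1 0))
  simp only [Matrix.inv_def, Ring.inverse_eq_inv', Matrix.adjugate_fin_two, Matrix.smul_apply,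
    smul_eq_mul]
  refine hdet.mul ?_
  fin_cases i <;> fin_cases j
  · exact h 1 1
  · exact (h 0 1).neg
  · exact (h 1 0).neg
  · exact h 0 0

theorem metric_mul_inv {G : Matrix (Fin 2) (Fin 2) ℝ} (hG : G.det ≠ 0) (b : Fin 2 → ℝ)
    (m : Fin 2) : ∑ k, G m k * ∑ l, G⁻¹ k l * b l = b m := by
  have : G.mulVec (G⁻¹.mulVec b) = b := by
    rw [Matrix.mulVec_mulVec, Matrix.mul_nonsing_inv _ (isUnit_iff_ne_zero.2 hG),
      Matrix.one_mulVec]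
  exact congrFun this m

/-- For an induced metric the Koszul formula collapses: four of the six products cancel by symmetry
of second derivatives. -/
theorem christoffel_metricLoc (hF : ContDiff ℝ ∞ F) (k i j : Fin 2) (x : Plane) :
    christoffel (metricLoc F) k i j x =
      ∑ l, (metricLoc F x)⁻¹ k l * lor (pd i (pd j F) x) (pd l F x) := by
  unfold christoffel
  rw [Finset.mul_sum]
  refine Finset.sum_congr rfl fun l _ => ?_
  simp only [metricLoc_apply]
  have h := fun i => (hF.pd i).diffAt x
  rw [pd_lor (h j) (h l), pd_lor (h i) (h l), pd_lor (h i) (h j), pd_comm hF j i,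
    pd_comm hF l i, pd_comm hF l j, lor_comm (pd j F x) (pd i (pd l F) x),
    lor_comm (pd i F x) (pd j (pd l F) x)]
  ring

theorem contDiff_christoffel (hF : ContDiff ℝ ∞ F) (hG : ∀ x, (metricLoc F x).det ≠ 0)
    (k i j : Fin 2) : ContDiff ℝ ∞ (christoffel (metricLoc F) k i j) := by
  have : christoffel (metricLoc F) k i j = fun x =>
      ∑ l, (metricLoc F x)⁻¹ k l * lor (pd i (pd j F) x) (pd l F x) :=
    funext fun x => christoffel_metricLoc hF k i j x
  rw [this]
  exact ContDiff.sum fun l _ => (contDiff_metricLoc_inv hF hG k l).mul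
    (((hF.pd j).pd i).lor (hF.pd l))

theorem sum_metricLoc_mul_christoffel (hF : ContDiff ℝ ∞ F) {x : Plane}
    (hG : (metricLoc F x).det ≠ 0) (m i j : Fin 2) :
    ∑ k, metricLoc F x m k * christoffel (metricLoc F) k i j x =
      lor (pd i (pd j F) x) (pd m F x) := by
  simp only [christoffel_metricLoc hF]
  exact metric_mul_inv hG (fun l => lor (pd i (pd j F) x) (pd l F x)) m

/-- The **Gauss equation** for a spacelike surface of Lorentz-Minkowski spacetime, with the normal
components of second derivatives expressed by Christoffel symbols. -/
theorem gaussOfMetric_mul_det (hF : ContDiff ℝ ∞ F) (hG : ∀ x, (metricLoc F x).det ≠ 0)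
    (x : Plane) :
    gaussOfMetric (metricLoc F) x * (metricLoc F x).det =
      lor (pd 0 (pd 0 F) x) (pd 1 (pd 1 F) x -
          ∑ l, christoffel (metricLoc F) l 1 1 x • pd l F x) -
        lor (pd 0 (pd 1 F) x) (pd 0 (pd 1 F) x -
          ∑ l, christoffel (metricLoc F) l 0 1 x • pd l F x) := by
  unfold gaussOfMetric
  rw [div_mul_cancel₀ _ (hG x)]
  have hΓ := fun k i j => contDiff_christoffel hF hG k i j
  have hg := contDiff_metricLoc hF
  have key := fun m i j y => sum_metricLoc_mul_christoffel hF (hG y) m i j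
  simp only [Fin.sum_univ_two] at key
  have hd := fun i => (hF.pd i).diffAt x
  have hd2 := fun i j => ((hF.pd i).pd j).diffAt x
  -- Differentiating `∑ gₘₖ Γᵏᵢⱼ = ⟨∂ᵢ∂ⱼF, ∂ₘF⟩` replaces derivatives of `Γ` by third derivatives of
  -- `F`, without differentiating the inverse metric.
  have diff : ∀ n m i j, pd n (metricLoc F · m 0) x * christoffel (metricLoc F) 0 i j x +
        metricLoc F x m 0 * pd n (christoffel (metricLoc F) 0 i j) x +
        (pd n (metricLoc F · m 1) x * christoffel (metricLoc F) 1 i j x +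
        metricLoc F x m 1 * pd n (christoffel (metricLoc F) 1 i j) x) =
      lor (pd n (pd i (pd j F)) x) (pd m F x) + lor (pd i (pd j F) x) (pd n (pd m F) x) := by
    intro n m i j
    have h1 : (fun y => metricLoc F y m 0 * christoffel (metricLoc F) 0 i j y +
        metricLoc F y m 1 * christoffel (metricLoc F) 1 i j y) =
        fun y => lor (pd i (pd j F) y) (pd m F y) := funext fun y => key m i j y
    have h2 : pd n (fun y => metricLoc F y m 0 * christoffel (metricLoc F) 0 i j y +
        metricLoc F y m 1 * christoffel (metricLoc F) 1 i j y) x =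
        pd n (fun y => lor (pd i (pd j F) y) (pd m F y)) x := by rw [h1]
    rw [pd_lor (hd2 j i) (hd m), pd_add (((hg m 0).mul (hΓ 0 i j)).diffAt x)
      (((hg m 1).mul (hΓ 1 i j)).diffAt x), pd_mul ((hg m 0).diffAt x) ((hΓ 0 i j).diffAt x),
      pd_mul ((hg m 1).diffAt x) ((hΓ 1 i j).diffAt x)] at h2
    exact h2
  have dg : ∀ n i j, pd n (metricLoc F · i j) x =
      lor (pd n (pd i F) x) (pd j F x) + lor (pd i F x) (pd n (pd j F) x) :=
    fun n i j => pd_lor (hd i) (hd j) n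
  have d1 := diff 0 0 1 1
  have d2 := diff 1 0 0 1
  rw [dg, dg] at d1 d2
  -- The third derivatives in `d1` and `d2` agree, so they cancel in the curvature.
  have c1 : pd 1 (pd 0 (pd 1 F)) x = pd 0 (pd 1 (pd 1 F)) x := pd_comm (hF.pd 1) 1 0 x
  have c2 : pd 1 (pd 0 F) x = pd 0 (pd 1 F) x := pd_comm hF 1 0 x
  rw [c1, c2] at d2
  have k1 := key 0 0 0 x
  have k2 := key 0 0 1 x
  have k3 := key 0 1 0 x
  have k4 := key 0 1 1 x
  rw [c2] at k3
  unfold riemann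
  simp only [Fin.sum_univ_two, lor_sub_right, lor_add_right, lor_smul_right]
  rw [lor_comm (pd 0 (pd 0 F) x) (pd 1 (pd 1 F) x)]
  have s : ∀ v i, lor (pd i F x) v = lor v (pd i F x) := fun v i => lor_comm _ _
  simp only [s (pd 0 (pd _ F) x), s (pd 1 (pd _ F) x)] at d1 d2
  linear_combination d1 - d2 + christoffel (metricLoc F) 0 1 1 x * k1 +
    christoffel (metricLoc F) 1 1 1 x * k2 - christoffel (metricLoc F) 0 0 1 x * k3 -
    christoffel (metricLoc F) 1 0 1 x * k4

end LocalMetric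

/-! ### Parametrised surfaces in the cone and their null normal -/

section LocalCone

/-- A spacelike parametrised surface in the future cone. -/
structure IsConeSurface (F : Plane → L4) : Prop where
  smooth : ContDiff ℝ ∞ F
  cone : ∀ x, F x ∈ futureCone
  pos : ∀ x v, v ≠ 0 → 0 < lor (fderiv ℝ F x v) (fderiv ℝ F x v)

/-- The gradient of the time component of a parametrised surface. -/
def gradLoc (F : Plane → L4) (x : Plane) (i : Fin 2) : ℝ :=
  ∑ j, (metricLoc F x)⁻¹ i j * pd j (fun y => F y 0) x

/-- The conjugate null normal field of a parametrised surface in the future cone. -/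
def etaLoc (F : Plane → L4) (x : Plane) : L4 :=
  ((1 + ∑ i, ∑ j, metricLoc F x i j * gradLoc F x i * gradLoc F x j) / (2 * (F x 0) ^ 2)) • F x
    - (1 / F x 0) • (e0 + ∑ i, gradLoc F x i • pd i F x)

namespace IsConeSurface

variable {F : Plane → L4}

theorem metricLoc_diag_pos (h : IsConeSurface F) (x : Plane) (i : Fin 2) :
    0 < metricLoc F x i i :=
  h.pos x _ (by simp)

theorem det_pos (h : IsConeSurface F) (x : Plane) : 0 < (metricLoc F x).det := by
  have h0 := h.metricLoc_diag_pos x 0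
  -- This vector is a multiple of the Gram-Schmidt step, with squared length `g₀₀ det g`.
  have hv := h.pos x (-(metricLoc F x 0 1) • EuclideanSpace.single 0 1 +
    (metricLoc F x 0 0) • EuclideanSpace.single 1 1) (by
      intro h'
      have := congrArg (fun v : Plane => v 1) h'
      simp at this
      exact h0.ne' this)
  simp only [map_add, map_smul] at hv
  change 0 < lor (-(metricLoc F x 0 1) • pd 0 F x + metricLoc F x 0 0 • pd 1 F x)
    (-(metricLoc F x 0 1) • pd 0 F x + metricLoc F x 0 0 • pd 1 F x) at hv
  simp only [lor_add_left, lor_add_right, lor_smul_left, lor_smul_right,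
    ← metricLoc_apply] at hv
  rw [Matrix.det_fin_two]
  rw [metricLoc_comm x 1 0] at hv ⊢
  by_contra! hle
  nlinarith

theorem lor_pd (h : IsConeSurface F) (x : Plane) (i : Fin 2) : lor (F x) (pd i F x) = 0 := by
  have h1 : (fun y => lor (F y) (F y)) = fun _ => 0 := funext fun y => (h.cone y).1
  have h2 := congrArg (fun f => pd i f x) h1
  simp only [pd_lor (h.smooth.diffAt x) (h.smooth.diffAt x), pd_const] at h2
  rw [lor_comm] at h2
  linarith

/-- The shape operator of the position vector is `-I` on every surface in the cone. -/
theorem lor_pd_pd (h : IsConeSurface F) (x : Plane) (i j : Fin 2) :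
    lor (F x) (pd i (pd j F) x) = -metricLoc F x i j := by
  have h1 : (fun y => lor (F y) (pd j F y)) = fun _ => 0 := funext fun y => h.lor_pd y j
  have h2 := congrArg (fun f => pd i f x) h1
  simp only [pd_lor (h.smooth.diffAt x) ((h.smooth.pd j).diffAt x), pd_const] at h2
  rw [metricLoc_apply]
  linarith

theorem sum_metric_grad (h : IsConeSurface F) (x : Plane) (i : Fin 2) :
    ∑ j, metricLoc F x i j * gradLoc F x j = pd i F x 0 := by
  rw [← pd_apply (h.smooth.diffAt x)]
  exact metric_mul_inv (h.det_pos x).ne' _ i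

theorem isNullFrame (h : IsConeSurface F) (x : Plane) :
    IsNullFrame (F x) (etaLoc F x) (fun i => pd i F x) := by
  have hp := (h.cone x).2
  have g0 := h.sum_metric_grad x 0
  have g1 := h.sum_metric_grad x 1
  have hFF := (h.cone x).1
  have f0 := h.lor_pd x 0
  have f1 := h.lor_pd x 1
  simp only [Fin.sum_univ_two, metricLoc_apply] at g0 g1
  rw [lor_comm (pd 1 F x) (pd 0 F x)] at g1
  have hη : ∀ v, lor (etaLoc F x) v =
      (1 + ∑ i, ∑ j, metricLoc F x i j * gradLoc F x i * gradLoc F x j) / (2 * (F x 0) ^ 2) *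
        lor (F x) v - 1 / F x 0 * (-v 0 + (gradLoc F x 0 * lor (pd 0 F x) v +
          gradLoc F x 1 * lor (pd 1 F x) v)) := by
    intro v
    simp [etaLoc, lor_e0_left]
    ring
  have hFE : lor (F x) (etaLoc F x) = 1 := by
    rw [lor_comm, hη, hFF, lor_comm _ (F x), f0, lor_comm _ (F x), f1]
    field_simp
    ring
  have hEt : ∀ i, lor (etaLoc F x) (pd i F x) = 0 := by
    intro i
    rw [hη, h.lor_pd x i]
    fin_cases i
    · simp only [Fin.zero_eta, Fin.isValue, lor_comm (pd 1 F x) (pd 0 F x)]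
      rw [← g0]; ring
    · simp only [Fin.mk_one, Fin.isValue]
      rw [← g1]; ring
  refine ⟨hFF, ?_, hFE, h.lor_pd x, hEt, ?_⟩
  · rw [hη, hFE, lor_comm _ (etaLoc F x), hEt, lor_comm _ (etaLoc F x), hEt]
    simp only [etaLoc, e0, Fin.sum_univ_two, Pi.sub_apply, Pi.add_apply, Pi.smul_apply,
      smul_eq_mul, Matrix.cons_val_zero, metricLoc_apply, lor_comm (pd 1 F x) (pd 0 F x)]
    rw [← g0, ← g1]
    field_simp
    ring
  · have := (h.det_pos x).ne'
    rw [Matrix.det_fin_two, metricLoc_comm x 1 0] at this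
    simpa only [metricLoc_apply, sq] using this

theorem contDiff_etaLoc (h : IsConeSurface F) : ContDiff ℝ ∞ (etaLoc F) := by
  have hF0 : ContDiff ℝ ∞ fun x => F x 0 := contDiff_pi.1 h.smooth 0
  have hne : ∀ x, F x 0 ≠ 0 := fun x => (h.cone x).2.ne'
  have hgrad : ∀ i, ContDiff ℝ ∞ fun x => gradLoc F x i := fun i =>
    ContDiff.sum fun j _ => (contDiff_metricLoc_inv h.smooth (fun x => (h.det_pos x).ne') i j).mul
      (hF0.pd j)
  have hG := contDiff_metricLoc h.smooth
  unfold etaLoc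
  refine ContDiff.sub (ContDiff.smul (ContDiff.div (contDiff_const.add ?_)
    (contDiff_const.mul (hF0.pow 2)) ?_) h.smooth) (ContDiff.smul (contDiff_const.div hF0 hne)
    (contDiff_const.add ?_))
  · exact ContDiff.sum fun i _ => ContDiff.sum fun j _ => ((hG i j).mul (hgrad i)).mul (hgrad j)
  · intro x; have := hne x; positivity
  · exact ContDiff.sum fun i _ => (hgrad i).smul (h.smooth.pd i)

/-- If the second fundamental form in the direction of the conjugate null normal is `c` times the
metric, then the Gauss curvature is `-2 c`. -/
theorem gaussOfMetric_eq (h : IsConeSurface F) {x : Plane} {c : ℝ}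
    (hc : ∀ i j, lor (pd i (pd j F) x) (etaLoc F x) = c * metricLoc F x i j) :
    gaussOfMetric (metricLoc F) x = -2 * c := by
  have hd := fun y => (h.det_pos y).ne'
  have hfr := h.isNullFrame x
  -- The Christoffel terms remove the tangential part; the normal rest is read off in the null
  -- frame, from `c` along `η` and `-1` along `F`.
  have II : ∀ i j, pd i (pd j F) x - ∑ l, christoffel (metricLoc F) l i j x • pd l F x =
      (c * metricLoc F x i j) • F x + (-metricLoc F x i j) • etaLoc F x := by
    intro i j
    have hn : ∀ m, lor (pd i (pd j F) x - ∑ l, christoffel (metricLoc F) l i j x • pd l F x)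
        (pd m F x) = 0 := by
      intro m
      rw [lor_sub_left, ← sum_metricLoc_mul_christoffel h.smooth (hd x) m i j]
      simp only [Fin.sum_univ_two, lor_add_left, lor_smul_left, metricLoc_apply,
        lor_comm (pd m F x)]
      ring
    have := hfr.normal_eq hn
    rw [this]
    simp only [Fin.sum_univ_two, lor_sub_left, lor_add_left, lor_smul_left]
    rw [hc, lor_comm _ (F x), h.lor_pd_pd, lor_comm _ (F x), h.lor_pd, lor_comm _ (F x), h.lor_pd,
      lor_comm _ (etaLoc F x), hfr.Et, lor_comm _ (etaLoc F x), hfr.Et]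
    simp
  have := gaussOfMetric_mul_det h.smooth hd x
  rw [II, II] at this
  simp only [lor_add_right, lor_smul_right, hc, lor_comm _ (F x), h.lor_pd_pd] at this
  apply mul_right_cancel₀ (hd x)
  rw [this, Matrix.det_fin_two, metricLoc_comm x 1 0]
  ring

end IsConeSurface

end LocalCone

/-! ### Stereographic parametrisations of the sphere -/

section Charts

/-- Stereographic projection is onto the plane, so inverse charts are globally smooth maps and the
local theory needs no domains. -/
theorem extChartAt_target_eq_univ (p : Sph) : (extChartAt (𝓡 2) p).target = Set.univ := by
  simp only [extChartAt, OpenPartialHomeomorph.extend_target, modelWithCornersSelf_coe_symm,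
    modelWithCornersSelf_coe, Set.range_id, Set.inter_univ, Set.preimage_id_eq, id]
  have := Fact.mk (@finrank_euclideanSpace_fin ℝ _ (2 + 1))
  exact stereographic'_target _

/-- The inverse of the preferred chart around `p`, a parametrisation of the sphere without the
antipode of `p`. -/
def param (p : Sph) (x : Plane) : Sph := (extChartAt (𝓡 2) p).symm x

theorem param_pt (p : Sph) : param p (pt p) = p := extChartAt_to_inv p

theorem contMDiff_param (p : Sph) : ContMDiff 𝓘(ℝ, Plane) (𝓡 2) ∞ (param p) := by
  have h := contMDiffOn_extChartAt_symm (I := 𝓡 2) (n := ∞) p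
  rw [extChartAt_target_eq_univ] at h
  exact contMDiffOn_univ.1 h

/-- The differential of the parametrisation. -/
def dparam (p : Sph) (x : Plane) : Plane →L[ℝ] TangentSpace (𝓡 2) (param p x) :=
  mfderiv 𝓘(ℝ, Plane) (𝓡 2) (param p) x

theorem dparam_injective (p : Sph) (x : Plane) : Function.Injective (dparam p x) := by
  have h := isInvertible_mfderivWithin_extChartAt_symm (I := 𝓡 2) (x := p) (y := x)
    (by rw [extChartAt_target_eq_univ]; trivial)
  simp only [modelWithCornersSelf_coe, Set.range_id, mfderivWithin_univ] at h
  exact h.injective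

theorem loc_pt (ψ : Sph → L4) (p : Sph) : loc ψ p (pt p) = ψ p := congrArg ψ (param_pt p)

theorem fderiv_loc {f : Sph → L4} {p : Sph} {x : Plane}
    (hf : MDifferentiableAt (𝓡 2) 𝓘(ℝ, L4) f (param p x)) (v : Plane) :
    fderiv ℝ (loc f p) x v = mfderiv (𝓡 2) 𝓘(ℝ, L4) f (param p x) (dparam p x v) := by
  have h := mfderiv_comp x hf ((contMDiff_param p x).mdifferentiableAt (by simp))
  rw [mfderiv_eq_fderiv] at h
  exact congrArg (fun L => L v) h

theorem mfderiv_eq_fderiv_loc {f : Sph → L4} {p : Sph}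
    (hf : MDifferentiableAt (𝓡 2) 𝓘(ℝ, L4) f p) (v : Plane) :
    mfderiv (𝓡 2) 𝓘(ℝ, L4) f p v = fderiv ℝ (loc f p) (pt p) v := by
  rw [hf.mfderiv]
  simp only [modelWithCornersSelf_coe, Set.range_id, fderivWithin_univ]
  rfl

theorem isNormalAt_iff {ψ : Sph → L4} {p : Sph} (hψ : MDifferentiableAt (𝓡 2) 𝓘(ℝ, L4) ψ p)
    (ξ : L4) : IsNormalAt ψ p ξ ↔ ∀ i, lor ξ (pd i (loc ψ p) (pt p)) = 0 := by
  constructor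
  · intro h i
    have := h (EuclideanSpace.single i (1 : ℝ))
    rwa [mfderiv_eq_fderiv_loc hψ] at this
  · intro h v
    have key : ∀ v : Plane, lor ξ (fderiv ℝ (loc ψ p) (pt p) v) = 0 := by
      intro v
      rw [fderiv_eq_sum_pd]
      simp [h]
    exact (congrArg (lor ξ) (mfderiv_eq_fderiv_loc hψ v)).trans (key v)

theorem IsNormalAt.pd_loc {ψ : Sph → L4} {p : Sph} {x : Plane}
    (hψ : MDifferentiableAt (𝓡 2) 𝓘(ℝ, L4) ψ (param p x)) {ξ : L4}
    (h : IsNormalAt ψ (param p x) ξ) (i : Fin 2) : lor ξ (pd i (loc ψ p) x) = 0 := by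
  unfold pd
  rw [fderiv_loc hψ]
  exact h _

theorem param_mem_nhds (p : Sph) : Set.range (param p) ∈ nhds p := by
  refine Filter.mem_of_superset (extChartAt_source_mem_nhds (I := 𝓡 2) p) ?_
  intro q hq
  exact ⟨extChartAt (𝓡 2) p q, (extChartAt (𝓡 2) p).left_inv hq⟩

instance preconnectedSpace_sph : PreconnectedSpace Sph :=
  Subtype.preconnectedSpace (isPreconnected_sphere (by simp [← Module.finrank_eq_rank]) 0 1)

/-- A function on the sphere whose differential vanishes in all charts is constant. -/
theorem eq_of_fderiv_eq_zero {E : Type*} [NormedAddCommGroup E] [NormedSpace ℝ E] {f : Sph → E}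
    (hd : ∀ p, Differentiable ℝ fun x => f (param p x))
    (h0 : ∀ p x, fderiv ℝ (fun x => f (param p x)) x = 0) (p q : Sph) : f p = f q := by
  refine IsLocallyConstant.apply_eq_of_preconnectedSpace ?_ p q
  rw [IsLocallyConstant.iff_eventually_eq]
  intro p
  filter_upwards [param_mem_nhds p]
  rintro _ ⟨x, rfl⟩
  have := is_const_of_fderiv_eq_zero (hd p) (h0 p) x (pt p)
  rwa [param_pt] at this

end Charts

/-! ### Transfer of the local theory to the sphere -/

section Surface

variable {ψ : Sph → L4}

theorem IsSpacelikeImmersion.mdifferentiable (h : IsSpacelikeImmersion ψ) (p : Sph) :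
    MDifferentiableAt (𝓡 2) 𝓘(ℝ, L4) ψ p :=
  (h.1 p).mdifferentiableAt (by simp)

theorem IsSpacelikeImmersion.isConeSurface (h : IsSpacelikeImmersion ψ)
    (hc : ∀ p, ψ p ∈ futureCone) (p : Sph) : IsConeSurface (loc ψ p) where
  smooth := (h.1.comp (contMDiff_param p)).contDiff
  cone x := hc _
  pos x v hv := by
    rw [fderiv_loc (h.mdifferentiable _)]
    refine h.2 _ _ fun h0 => hv (dparam_injective p x ?_)
    rw [h0, map_zero]

theorem etaField_eq (ψ : Sph → L4) (p : Sph) : etaField ψ p = etaLoc (loc ψ p) (pt p) := by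
  unfold etaLoc
  rw [loc_pt]
  rfl

theorem metricCoeff_eq (ψ : Sph → L4) (p : Sph) : metricCoeff ψ p = metricLoc (loc ψ p) := rfl

theorem isConjugateNullNormal_etaField (h : IsSpacelikeImmersion ψ)
    (hc : ∀ p, ψ p ∈ futureCone) : IsConjugateNullNormal ψ (etaField ψ) := by
  intro p
  have hf := (h.isConeSurface hc p).isNullFrame (pt p)
  rw [isNormalAt_iff (h.mdifferentiable p)]
  rw [loc_pt, ← etaField_eq] at hf
  exact ⟨hf.Et, hf.EE, hf.FE⟩

theorem isNullFrame_etaField (h : IsSpacelikeImmersion ψ) (hc : ∀ p, ψ p ∈ futureCone) (p : Sph) :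
    IsNullFrame (ψ p) (etaField ψ p) fun i => pd i (loc ψ p) (pt p) := by
  have hf := (h.isConeSurface hc p).isNullFrame (pt p)
  rwa [loc_pt, ← etaField_eq] at hf

/-- The conjugate null normal does not depend on the chart used to compute it. -/
theorem etaField_param (h : IsSpacelikeImmersion ψ) (hc : ∀ p, ψ p ∈ futureCone) (p : Sph)
    (x : Plane) : etaField ψ (param p x) = etaLoc (loc ψ p) x := by
  obtain ⟨h1, h2, h3⟩ := isConjugateNullNormal_etaField h hc (param p x)
  exact ((h.isConeSurface hc p).isNullFrame x).unique
    (fun i => h1.pd_loc (h.mdifferentiable _) i) h2 h3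

theorem loc_etaField (h : IsSpacelikeImmersion ψ) (hc : ∀ p, ψ p ∈ futureCone) (p : Sph) :
    loc (etaField ψ) p = etaLoc (loc ψ p) :=
  funext (etaField_param h hc p)

theorem lor_secondFF {p : Sph} {ξ : L4} (hξ : ∀ i, lor ξ (pd i (loc ψ p) (pt p)) = 0)
    (i j : Fin 2) : lor (secondFF ψ p i j) ξ = lor (pd i (pd j (loc ψ p)) (pt p)) ξ := by
  have : ∀ k, lor (pd k (loc ψ p) (pt p)) ξ = 0 := fun k => by rw [lor_comm, hξ]
  simp [secondFF, tangentPart, this]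

/-- The shape operator in a normal direction is `c` times the identity if and only if the second
fundamental form in this direction is `c` times the metric. -/
theorem shapeOp_eq_smul_one_iff (h : IsSpacelikeImmersion ψ) (hc : ∀ p, ψ p ∈ futureCone)
    {p : Sph} {ξ : L4} (hξ : ∀ i, lor ξ (pd i (loc ψ p) (pt p)) = 0) (c : ℝ) :
    shapeOp ψ p ξ = c • (1 : Matrix (Fin 2) (Fin 2) ℝ) ↔
      ∀ i j, lor (pd i (pd j (loc ψ p)) (pt p)) ξ = c * metricLoc (loc ψ p) (pt p) i j := by
  have hd : IsUnit (metricLoc (loc ψ p) (pt p)).det :=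
    isUnit_iff_ne_zero.2 ((h.isConeSurface hc p).det_pos _).ne'
  unfold shapeOp
  simp only [lor_secondFF hξ, metricCoeff_eq]
  constructor
  · intro h' i j
    have := congrArg (fun B => metricLoc (loc ψ p) (pt p) * B) h'
    simp only [Matrix.mul_nonsing_inv_cancel_left _ _ hd, Matrix.mul_smul, Matrix.mul_one] at this
    exact congrFun (congrFun this i) j
  · intro h'
    have : (Matrix.of fun i j => lor (pd i (pd j (loc ψ p)) (pt p)) ξ) =
        c • metricLoc (loc ψ p) (pt p) := by
      ext i j
      simp [h']
    rw [this, Matrix.mul_smul, Matrix.nonsing_inv_mul _ hd]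

/-- With `A_ψ = -I` and `A_η = c I`, each of the two mixed terms of the Gauss equation contributes
`-c`. -/
theorem gaussCurvature_eq (h : IsSpacelikeImmersion ψ) (hc : ∀ p, ψ p ∈ futureCone) {p : Sph}
    {c : ℝ} (hA : shapeOp ψ p (etaField ψ p) = c • (1 : Matrix (Fin 2) (Fin 2) ℝ)) :
    gaussCurvature ψ p = -2 * c := by
  refine (h.isConeSurface hc p).gaussOfMetric_eq ?_
  rw [← etaField_eq]
  exact (shapeOp_eq_smul_one_iff h hc (isNullFrame_etaField h hc p).Et c).1 hA

end Surface

/-! ### The round spheres: immersion, embedding and image -/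

section Round

/-- The inclusion of space in spacetime. -/
def spaceIncl : EuclideanSpace ℝ (Fin 3) →L[ℝ] L4 :=
  ContinuousLinearMap.pi ![0, EuclideanSpace.proj 0, EuclideanSpace.proj 1, EuclideanSpace.proj 2]

theorem stdEmb_eq (x : Sph) : stdEmb x = e0 + spaceIncl x.1 := by
  ext k
  fin_cases k <;> simp [stdEmb, e0, spaceIncl]

theorem lor_spaceIncl (y : EuclideanSpace ℝ (Fin 3)) :
    lor (spaceIncl y) (spaceIncl y) = ‖y‖ ^ 2 := by
  rw [EuclideanSpace.norm_sq_eq]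
  simp [lor, spaceIncl, Fin.sum_univ_three]
  ring

theorem stdEmb_mem_futureCone (x : Sph) : stdEmb x ∈ futureCone := by
  have h : ‖x.1‖ ^ 2 = 1 := by rw [norm_eq_of_mem_sphere]; norm_num
  rw [EuclideanSpace.norm_sq_eq, Fin.sum_univ_three] at h
  simp only [Real.norm_eq_abs, sq_abs] at h
  refine ⟨?_, by simp [stdEmb]⟩
  simp [lor, stdEmb]
  linarith

theorem contMDiff_sphere_val :
    ContMDiff (𝓡 2) 𝓘(ℝ, EuclideanSpace ℝ (Fin 3)) ∞ (fun x : Sph => x.1) := by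
  have := Fact.mk (@finrank_euclideanSpace_fin ℝ _ (2 + 1))
  exact contMDiff_coe_sphere (n := 2)

theorem contMDiff_stdEmb : ContMDiff (𝓡 2) 𝓘(ℝ, L4) ∞ stdEmb := by
  have h : ContDiff ℝ ∞ fun y : EuclideanSpace ℝ (Fin 3) => e0 + spaceIncl y :=
    contDiff_const.add spaceIncl.contDiff
  exact (h.contMDiff.comp contMDiff_sphere_val).congr stdEmb_eq

theorem contDiff_val_param (p : Sph) : ContDiff ℝ ∞ fun x => (param p x).1 :=
  (contMDiff_sphere_val.comp (contMDiff_param p)).contDiff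

theorem fderiv_val_param_ne_zero (p : Sph) {v : Plane} (hv : v ≠ 0) :
    fderiv ℝ (fun x => (param p x).1) (pt p) v ≠ 0 := by
  have := Fact.mk (@finrank_euclideanSpace_fin ℝ _ (2 + 1))
  have hinj := injective_mvfderiv_subtypeVal_sphere (n := 2) p
  rw [((contMDiff_sphere_val p).mdifferentiableAt (by simp)).mvfderiv] at hinj
  simp only [modelWithCornersSelf_coe, Set.range_id, fderivWithin_univ] at hinj
  intro h0
  exact hv (hinj (h0.trans (map_zero _).symm))

/-- As `φ` is null and orthogonal to its derivatives, the `dρ` terms drop out and the induced metric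
is `ρ²` times the round one. -/
theorem isSpacelikeImmersion_smul_stdEmb {ρ : Sph → ℝ} (hρ : ContMDiff (𝓡 2) 𝓘(ℝ, ℝ) ∞ ρ)
    (hpos : ∀ x, 0 < ρ x) : IsSpacelikeImmersion fun x => ρ x • stdEmb x := by
  have hs : ContMDiff (𝓡 2) 𝓘(ℝ, L4) ∞ fun x => ρ x • stdEmb x := hρ.smul contMDiff_stdEmb
  refine ⟨hs, fun p v hv => ?_⟩
  have key : ∀ v : Plane, v ≠ 0 → 0 < lor (fderiv ℝ (loc (fun x => ρ x • stdEmb x) p) (pt p) v)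
      (fderiv ℝ (loc (fun x => ρ x • stdEmb x) p) (pt p) v) := by
    intro v hv
    have hρ' : DifferentiableAt ℝ (fun x => ρ (param p x)) (pt p) :=
      ((hρ.comp (contMDiff_param p)).contDiff).diffAt _
    have hval := (contDiff_val_param p).diffAt (pt p)
    have hφ : HasFDerivAt (fun x => stdEmb (param p x))
        (spaceIncl ∘L fderiv ℝ (fun x => (param p x).1) (pt p)) (pt p) := by
      simp only [stdEmb_eq]
      exact (spaceIncl.hasFDerivAt.comp (pt p) hval.hasFDerivAt).const_add e0
    have hnull : lor (stdEmb p) (spaceIncl (fderiv ℝ (fun x => (param p x).1) (pt p) v)) = 0 := by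
      have hn : (fun x => lor (stdEmb (param p x)) (stdEmb (param p x))) = fun _ => 0 :=
        funext fun x => (stdEmb_mem_futureCone _).1
      have hd : ∀ i, lor (stdEmb p)
          (spaceIncl (fderiv ℝ (fun x => (param p x).1) (pt p) (EuclideanSpace.single i 1))) = 0 := by
        intro i
        have h2 : pd i (fun x => lor (stdEmb (param p x)) (stdEmb (param p x))) (pt p) = 0 := by
          rw [hn, pd_const]
        rw [pd_lor hφ.differentiableAt hφ.differentiableAt, param_pt, lor_comm _ (stdEmb p)] at h2
        unfold pd at h2
        rw [hφ.fderiv] at h2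
        simp only [ContinuousLinearMap.comp_apply] at h2
        linarith
      rw [fderiv_eq_sum_pd]
      unfold pd
      simp [hd]
    have hfd := (hρ'.hasFDerivAt.smul hφ).fderiv
    rw [show loc (fun x => ρ x • stdEmb x) p =
      (fun x => ρ (param p x)) • (fun x => stdEmb (param p x)) from rfl, hfd]
    simp only [param_pt, add_apply, smul_apply,
      ContinuousLinearMap.smulRight_apply, ContinuousLinearMap.comp_apply, lor_add_left,
      lor_add_right, lor_smul_left, lor_smul_right, hnull, lor_comm _ (stdEmb p),
      (stdEmb_mem_futureCone p).1, lor_spaceIncl]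
    have h1 := hpos p
    have h2 := norm_pos_iff.2 (fderiv_val_param_ne_zero p hv)
    ring_nf
    positivity
  have hm := mfderiv_eq_fderiv_loc ((hs p).mdifferentiableAt (by simp)) v
  exact (key v hv).trans_eq (congrArg (fun w => lor w w) hm).symm

variable {u : L4} {r : ℝ}

theorem lor_stdEmb_pos (hu : lor u u = -1) (hu0 : u 0 < 0) (x : Sph) : 0 < lor u (stdEmb x) :=
  lor_pos_of_past hu hu0 (stdEmb_mem_futureCone x)

theorem roundParam_eq (hu : lor u u = -1) (hu0 : u 0 < 0) (hr : 0 < r) (x : Sph) :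
    roundParam u r x = (r / lor u (stdEmb x)) • stdEmb x := by
  rw [roundParam, Real.exp_sub, Real.exp_log hr, Real.exp_log (lor_stdEmb_pos hu hu0 x)]

theorem isSpacelikeImmersion_roundParam (hu : lor u u = -1) (hu0 : u 0 < 0) (hr : 0 < r) :
    IsSpacelikeImmersion (roundParam u r) := by
  have h : roundParam u r = fun x => (r / lor u (stdEmb x)) • stdEmb x :=
    funext (roundParam_eq hu hu0 hr)
  have hpos := lor_stdEmb_pos hu hu0
  rw [h]
  refine isSpacelikeImmersion_smul_stdEmb ?_ fun x => div_pos hr (hpos x)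
  have hl : ContDiff ℝ ∞ fun y : L4 => lor u y := contDiff_const.lor contDiff_id
  exact contMDiff_const.div₀ (hl.contMDiff.comp contMDiff_stdEmb) fun x => (hpos x).ne'

theorem roundParam_mem_S2 (hu : lor u u = -1) (hu0 : u 0 < 0) (hr : 0 < r) (x : Sph) :
    roundParam u r x ∈ S2 u r := by
  have := (lor_stdEmb_pos hu hu0 x).ne'
  rw [roundParam_eq hu hu0 hr]
  constructor
  · simp [(stdEmb_mem_futureCone x).1]
  · simp [this]

theorem range_roundParam (hu : lor u u = -1) (hu0 : u 0 < 0) (hr : 0 < r) :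
    Set.range (roundParam u r) = S2 u r := by
  apply Set.Subset.antisymm
  · rintro _ ⟨x, rfl⟩
    exact roundParam_mem_S2 hu hu0 hr x
  · intro y hy
    have hy0 : 0 < y 0 := (S2_subset_futureCone hu hu0 hr hy).2
    -- The preimage of `y` is the direction of its spatial part, of length `y 0` because `y` is
    -- null.
    have hm : !₂[y 1 / y 0, y 2 / y 0, y 3 / y 0] ∈
        Metric.sphere (0 : EuclideanSpace ℝ (Fin 3)) 1 := by
      rw [mem_sphere_zero_iff_norm, EuclideanSpace.norm_eq, Real.sqrt_eq_one]
      have := hy.1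
      unfold lor at this
      simp [Fin.sum_univ_three]
      field_simp
      linarith
    have hs : stdEmb ⟨_, hm⟩ = (1 / y 0) • y := by
      ext k
      fin_cases k <;> simp [stdEmb] <;> field_simp
    refine ⟨⟨_, hm⟩, ?_⟩
    rw [roundParam_eq hu hu0 hr, hs, smul_smul, lor_smul_right, hy.2]
    have : r / (1 / y 0 * r) * (1 / y 0) = 1 := by field_simp
    rw [this, one_smul]

theorem injective_roundParam (hu : lor u u = -1) (hu0 : u 0 < 0) (hr : 0 < r) :
    Function.Injective (roundParam u r) := by
  intro x y hxy
  rw [roundParam_eq hu hu0 hr, roundParam_eq hu hu0 hr] at hxy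
  have hpos := div_pos hr (lor_stdEmb_pos hu hu0 y)
  have h0 := congrFun hxy 0
  have hc : r / lor u (stdEmb x) = r / lor u (stdEmb y) := by simpa [stdEmb] using h0
  rw [hc] at hxy
  have hs := smul_right_injective L4 hpos.ne' hxy
  apply Subtype.ext
  ext k
  fin_cases k
  · simpa [stdEmb] using congrFun hs 1
  · simpa [stdEmb] using congrFun hs 2
  · simpa [stdEmb] using congrFun hs 3

theorem isEmbedding_roundParam (hu : lor u u = -1) (hu0 : u 0 < 0) (hr : 0 < r) :
    Topology.IsEmbedding (roundParam u r) :=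
  ((isSpacelikeImmersion_roundParam hu hu0 hr).1.continuous.isClosedEmbedding
    (injective_roundParam hu hu0 hr)).isEmbedding

end Round

/-! ### Surfaces in hyperplane sections, and umbilicity -/

section PlaneSections

variable {ψ : Sph → L4} {u : L4} {r : ℝ}

theorem lor_pd_loc_of_section (h : IsSpacelikeImmersion ψ) (hS : ∀ p, lor u (ψ p) = r) (p : Sph)
    (x : Plane) (i : Fin 2) : lor u (pd i (loc ψ p) x) = 0 := by
  have hd : ContDiff ℝ ∞ (loc ψ p) := (h.1.comp (contMDiff_param p)).contDiff
  have h1 : (fun x => lor u (loc ψ p x)) = fun _ => r := funext fun x => hS _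
  have h2 : pd i (fun x => lor u (loc ψ p x)) x = 0 := by rw [h1, pd_const]
  rw [pd_lor (differentiableAt_const u) (hd.diffAt _), pd_const] at h2
  simpa using h2

/-- A surface in the section `⟨u, ·⟩ = r` of the cone by a spacelike hyperplane has conjugate null
normal `u / r + ψ / (2 r²)`. -/
theorem etaField_of_section (h : IsSpacelikeImmersion ψ) (hc : ∀ p, ψ p ∈ futureCone)
    (hu : lor u u = -1) (hr : 0 < r) (hS : ∀ p, lor u (ψ p) = r) (p : Sph) :
    etaField ψ p = (1 / r) • u + (1 / (2 * r ^ 2)) • ψ p := by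
  have hfr := isNullFrame_etaField h hc p
  have hun := lor_pd_loc_of_section h hS p (pt p)
  symm
  apply hfr.unique
  · intro i
    simp [hun, hfr.Ft]
  · simp only [lor_add_left, lor_add_right, lor_smul_left, lor_smul_right, hu, hS, hfr.FF,
      lor_comm (ψ p) u]
    field_simp
    ring
  · simp only [lor_add_right, lor_smul_right, hfr.FF, lor_comm (ψ p) u, hS]
    field_simp
    ring

theorem shapeOp_of_section (h : IsSpacelikeImmersion ψ) (hc : ∀ p, ψ p ∈ futureCone)
    (hu : lor u u = -1) (hr : 0 < r) (hS : ∀ p, lor u (ψ p) = r) (p : Sph) :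
    shapeOp ψ p (etaField ψ p) = (-(1 / (2 * r ^ 2))) • (1 : Matrix (Fin 2) (Fin 2) ℝ) := by
  have hfr := isNullFrame_etaField h hc p
  have hcs := h.isConeSurface hc p
  rw [shapeOp_eq_smul_one_iff h hc hfr.Et]
  intro i j
  have hun := fun y => lor_pd_loc_of_section h hS p y j
  have hu2 : lor u (pd i (pd j (loc ψ p)) (pt p)) = 0 := by
    have h2 : pd i (fun x => lor u (pd j (loc ψ p) x)) (pt p) = 0 := by
      rw [show (fun x => lor u (pd j (loc ψ p) x)) = fun _ => 0 from funext hun, pd_const]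
    rw [pd_lor (differentiableAt_const u) ((hcs.smooth.pd j).diffAt _), pd_const] at h2
    simpa using h2
  have hF := hcs.lor_pd_pd (pt p) i j
  rw [loc_pt] at hF
  rw [etaField_of_section h hc hu hr hS, lor_comm]
  simp only [lor_add_left, lor_smul_left, hu2, hF]
  ring

/-- A surface in the cone is totally umbilical as soon as the shape operators of its conjugate null
normal are multiples of the identity. -/
theorem isTotallyUmbilical_of_shapeOp (h : IsSpacelikeImmersion ψ) (hc : ∀ p, ψ p ∈ futureCone)
    (hA : ∀ p, ∃ c : ℝ, shapeOp ψ p (etaField ψ p) = c • (1 : Matrix (Fin 2) (Fin 2) ℝ)) :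
    IsTotallyUmbilical ψ := by
  intro p ξ hξ
  have hfr := isNullFrame_etaField h hc p
  have hcs := h.isConeSurface hc p
  rw [isNormalAt_iff (h.mdifferentiable p)] at hξ
  obtain ⟨c, hA⟩ := hA p
  rw [shapeOp_eq_smul_one_iff h hc hfr.Et] at hA
  refine ⟨-lor ξ (etaField ψ p) + lor ξ (ψ p) * c, ?_⟩
  rw [shapeOp_eq_smul_one_iff h hc hξ]
  intro i j
  have hF := hcs.lor_pd_pd (pt p) i j
  rw [loc_pt, lor_comm] at hF
  have hdec := hfr.normal_eq hξ
  calc lor (pd i (pd j (loc ψ p)) (pt p)) ξ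
      = lor (pd i (pd j (loc ψ p)) (pt p))
          (lor ξ (etaField ψ p) • ψ p + lor ξ (ψ p) • etaField ψ p) := by rw [← hdec]
    _ = _ := by
      rw [lor_add_right, lor_smul_right, lor_smul_right, hF, hA]
      ring

end PlaneSections

/-! ### Rigidity of totally umbilical spheres -/

section Umbilical

variable {ψ : Sph → L4}

/-- At each point `etaField` uses that point's own chart; regularity holds because near `p` it
agrees with `etaLoc` in the single chart of `p`. -/
theorem mdifferentiable_etaField (h : IsSpacelikeImmersion ψ) (hc : ∀ p, ψ p ∈ futureCone)
    (p : Sph) : MDifferentiableAt (𝓡 2) 𝓘(ℝ, L4) (etaField ψ) p := by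
  have hd : Differentiable ℝ (loc (etaField ψ) p) := by
    rw [loc_etaField h hc]
    exact (h.isConeSurface hc p).contDiff_etaLoc.differentiable (by simp)
  have h1 : MDifferentiableAt (𝓡 2) 𝓘(ℝ, L4) (loc (etaField ψ) p ∘ extChartAt (𝓡 2) p) p :=
    (hd _).mdifferentiableAt.comp p (mdifferentiableAt_extChartAt (mem_chart_source _ p))
  refine h1.congr_of_eventuallyEq ?_
  filter_upwards [extChartAt_source_mem_nhds (I := 𝓡 2) p] with q hq
  exact (congrArg (etaField ψ) ((extChartAt (𝓡 2) p).left_inv hq)).symm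

/-- The Weingarten equation for the conjugate null normal of a totally umbilical surface. -/
theorem mfderiv_etaField (h : IsSpacelikeImmersion ψ) (hc : ∀ p, ψ p ∈ futureCone) {p : Sph}
    {c : ℝ} (hA : shapeOp ψ p (etaField ψ p) = c • (1 : Matrix (Fin 2) (Fin 2) ℝ)) (v : Plane) :
    mfderiv (𝓡 2) 𝓘(ℝ, L4) (etaField ψ) p v = (-c) • mfderiv (𝓡 2) 𝓘(ℝ, L4) ψ p v := by
  have hcs := h.isConeSurface hc p
  have hfr := hcs.isNullFrame (pt p)
  rw [shapeOp_eq_smul_one_iff h hc (isNullFrame_etaField h hc p).Et, etaField_eq] at hA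
  have hη := hcs.contDiff_etaLoc
  have hηd := hη.diffAt (pt p)
  have hFd := hcs.smooth.diffAt (pt p)
  -- Tested against the null frame by differentiating `⟨η, ψ⟩ = 1`, `⟨η, η⟩ = 0` and `⟨η, ∂ⱼψ⟩ = 0`;
  -- only the last one uses umbilicity.
  have key : ∀ i, pd i (etaLoc (loc ψ p)) (pt p) + c • pd i (loc ψ p) (pt p) = 0 := by
    intro i
    apply hfr.eq_zero
    · have h2 : pd i (fun x => lor (etaLoc (loc ψ p) x) (loc ψ p x)) (pt p) = 0 := by
        rw [show (fun x => lor (etaLoc (loc ψ p) x) (loc ψ p x)) = fun _ => 1 from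
          funext fun x => (lor_comm _ _).trans (hcs.isNullFrame x).FE, pd_const]
      rw [pd_lor hηd hFd, hfr.Et, add_zero] at h2
      rw [lor_add_left, h2, lor_smul_left, lor_comm _ (loc ψ p (pt p)), hfr.Ft]
      simp
    · have h2 : pd i (fun x => lor (etaLoc (loc ψ p) x) (etaLoc (loc ψ p) x)) (pt p) = 0 := by
        rw [show (fun x => lor (etaLoc (loc ψ p) x) (etaLoc (loc ψ p) x)) = fun _ => 0 from
          funext fun x => (hcs.isNullFrame x).EE, pd_const]
      rw [pd_lor hηd hηd, lor_comm (etaLoc (loc ψ p) (pt p))] at h2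
      rw [lor_add_left, lor_smul_left, lor_comm (pd i (loc ψ p) (pt p)), hfr.Et]
      linarith
    · intro j
      have h2 : pd i (fun x => lor (etaLoc (loc ψ p) x) (pd j (loc ψ p) x)) (pt p) = 0 := by
        rw [show (fun x => lor (etaLoc (loc ψ p) x) (pd j (loc ψ p) x)) = fun _ => 0 from
          funext fun x => (hcs.isNullFrame x).Et j, pd_const]
      rw [pd_lor hηd ((hcs.smooth.pd j).diffAt _), lor_comm (etaLoc (loc ψ p) (pt p)), hA] at h2
      rw [lor_add_left, lor_smul_left, ← metricLoc_apply]
      exact h2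
  have hv : fderiv ℝ (loc (etaField ψ) p) (pt p) v = (-c) • fderiv ℝ (loc ψ p) (pt p) v := by
    rw [loc_etaField h hc, fderiv_eq_sum_pd, fderiv_eq_sum_pd, Finset.smul_sum]
    refine Finset.sum_congr rfl fun i _ => ?_
    rw [eq_neg_of_add_eq_zero_left (key i)]
    module
  refine (mfderiv_eq_fderiv_loc (mdifferentiable_etaField h hc p) v).trans (hv.trans ?_)
  exact congrArg (fun w : L4 => (-c) • w) (mfderiv_eq_fderiv_loc (h.mdifferentiable p) v).symm

/-- The Weingarten equation at all points of one chart, so that it can be differentiated again. -/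
theorem pd_etaLoc (h : IsSpacelikeImmersion ψ) (hc : ∀ p, ψ p ∈ futureCone) {c : Sph → ℝ}
    (hA : ∀ p, shapeOp ψ p (etaField ψ p) = c p • (1 : Matrix (Fin 2) (Fin 2) ℝ)) (p : Sph)
    (x : Plane) (i : Fin 2) :
    pd i (etaLoc (loc ψ p)) x = (-c (param p x)) • pd i (loc ψ p) x := by
  rw [← loc_etaField h hc]
  unfold pd
  refine (fderiv_loc (mdifferentiable_etaField h hc _) _).trans ?_
  refine (mfderiv_etaField h hc (hA _) _).trans ?_
  exact congrArg (fun w : L4 => (-c (param p x)) • w) (fderiv_loc (h.mdifferentiable _) _).symm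

theorem fderiv_eq_zero_of_pd {E : Type*} [NormedAddCommGroup E] [NormedSpace ℝ E] {f : Plane → E}
    {x : Plane} (h : ∀ i, pd i f x = 0) : fderiv ℝ f x = 0 := by
  ext v
  rw [fderiv_eq_sum_pd]
  simp [h]

/-- The principal curvature of the conjugate null normal of a totally umbilical surface is
constant. -/
theorem principalCurvature_const (h : IsSpacelikeImmersion ψ) (hc : ∀ p, ψ p ∈ futureCone)
    {c : Sph → ℝ}
    (hA : ∀ p, shapeOp ψ p (etaField ψ p) = c p • (1 : Matrix (Fin 2) (Fin 2) ℝ)) (p q : Sph) :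
    c p = c q := by
  have hsm : ∀ p, ContDiff ℝ ∞ fun x => c (param p x) := by
    intro p
    have hcs := h.isConeSurface hc p
    -- Nothing is known about the regularity of `c`; this quotient of smooth functions supplies it.
    have e : (fun x => c (param p x)) = fun x =>
        -lor (pd 0 (etaLoc (loc ψ p)) x) (pd 0 (loc ψ p) x) / metricLoc (loc ψ p) x 0 0 := by
      funext x
      have := (hcs.metricLoc_diag_pos x 0).ne'
      rw [pd_etaLoc h hc hA, lor_smul_left, ← metricLoc_apply]
      field_simp
    rw [e]
    exact ((hcs.contDiff_etaLoc.pd 0).lor (hcs.smooth.pd 0)).neg.div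
      (contDiff_metricLoc hcs.smooth 0 0) fun x => (hcs.metricLoc_diag_pos x 0).ne'
  refine eq_of_fderiv_eq_zero (fun p => (hsm p).differentiable (by simp)) (fun p x => ?_) p q
  have hcs := h.isConeSurface hc p
  have hd : ∀ i j, pd i (pd j (etaLoc (loc ψ p))) x =
      (-pd i (fun x => c (param p x)) x) • pd j (loc ψ p) x +
        (-c (param p x)) • pd i (pd j (loc ψ p)) x := by
    intro i j
    rw [show pd j (etaLoc (loc ψ p)) = fun y => (-c (param p y)) • pd j (loc ψ p) y from
      funext fun y => pd_etaLoc h hc hA p y j, pd_smul ((hsm p).neg.diffAt x)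
        ((hcs.smooth.pd j).diffAt x), pd_neg]
  have h01 := hd 0 1
  rw [pd_comm hcs.contDiff_etaLoc 0 1, hd 1 0, pd_comm hcs.smooth 1 0] at h01
  -- The Codazzi equation: equating mixed derivatives of `η` leaves a relation between the
  -- independent vectors `∂₀ψ` and `∂₁ψ`, so both coefficients vanish.
  have heq : pd 0 (fun x => c (param p x)) x • pd 1 (loc ψ p) x =
      pd 1 (fun x => c (param p x)) x • pd 0 (loc ψ p) x := by
    have h02 := add_right_cancel h01
    rw [neg_smul, neg_smul, neg_inj] at h02
    exact h02.symm
  have e0 := congrArg (fun w => lor w (pd 0 (loc ψ p) x)) heq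
  have e1 := congrArg (fun w => lor w (pd 1 (loc ψ p) x)) heq
  simp only [lor_smul_left, ← metricLoc_apply] at e0 e1
  have hdet := (hcs.det_pos x).ne'
  rw [Matrix.det_fin_two] at hdet
  apply fderiv_eq_zero_of_pd
  intro i
  refine (mul_eq_zero.1 ?_).resolve_right hdet
  fin_cases i
  · simp only [Fin.zero_eta]
    linear_combination metricLoc (loc ψ p) x 0 0 * e1 - metricLoc (loc ψ p) x 0 1 * e0
  · simp only [Fin.mk_one]
    linear_combination metricLoc (loc ψ p) x 1 0 * e1 - metricLoc (loc ψ p) x 1 1 * e0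

/-- For a totally umbilical surface with principal curvature `c`, the field `c ψ + η` is
constant. -/
theorem smul_add_etaField_const (h : IsSpacelikeImmersion ψ) (hc : ∀ p, ψ p ∈ futureCone) {c : ℝ}
    (hA : ∀ p, shapeOp ψ p (etaField ψ p) = c • (1 : Matrix (Fin 2) (Fin 2) ℝ)) (p q : Sph) :
    c • ψ p + etaField ψ p = c • ψ q + etaField ψ q := by
  have e : ∀ p, (fun x => c • ψ (param p x) + etaField ψ (param p x)) =
      fun x => c • loc ψ p x + etaLoc (loc ψ p) x := by
    intro p
    funext x
    rw [etaField_param h hc]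
    rfl
  refine eq_of_fderiv_eq_zero (f := fun p => c • ψ p + etaField ψ p) (fun p => ?_)
    (fun p x => ?_) p q
  · have hcs := h.isConeSurface hc p
    simp only [e]
    exact ((hcs.smooth.const_smul c).add hcs.contDiff_etaLoc).differentiable (by simp)
  · have hcs := h.isConeSurface hc p
    simp only [e]
    apply fderiv_eq_zero_of_pd
    intro i
    have hsm : ContDiff ℝ ∞ fun x => c • loc ψ p x := hcs.smooth.const_smul c
    rw [pd_add (hsm.diffAt x) (hcs.contDiff_etaLoc.diffAt x),
      pd_smul (differentiableAt_const c) (hcs.smooth.diffAt x), pd_const,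
      pd_etaLoc (c := fun _ => c) h hc hA]
    module

/-- A surface in the cone does not lie in a single null line. -/
theorem exists_lor_ne_zero (h : IsSpacelikeImmersion ψ) (hc : ∀ p, ψ p ∈ futureCone) (p : Sph) :
    ∃ q, lor (ψ p) (ψ q) ≠ 0 := by
  by_contra! h0
  have hcs := h.isConeSurface hc p
  have hpos := hcs.metricLoc_diag_pos (pt p) 0
  have hF0 : ContDiff ℝ ∞ fun x => loc ψ p x 0 := contDiff_pi.1 hcs.smooth 0
  -- Otherwise `ψ` is a function times the fixed null vector `ψ p`, so its derivatives are null,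
  -- against positivity of the metric.
  have e : loc ψ p = fun x => (loc ψ p x 0 / ψ p 0) • ψ p :=
    funext fun x => eq_smul_of_futureCone (hc p) (hc _) (h0 _)
  have hd : pd 0 (loc ψ p) (pt p) = pd 0 (fun x => loc ψ p x 0 / ψ p 0) (pt p) • ψ p := by
    conv_lhs => rw [e]
    rw [pd_smul ((hF0.div_const _).diffAt _) (differentiableAt_const _), pd_const]
    simp
  rw [metricLoc_apply, hd] at hpos
  simp [(hc p).1] at hpos

/-- At a maximum of `⟨y, ψ⟩` the vector `y` is normal. -/
theorem lor_pd_loc_eq_zero_of_forall_le (h : IsSpacelikeImmersion ψ) {y : L4} {p : Sph}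
    (hmax : ∀ q, lor y (ψ q) ≤ lor y (ψ p)) : ∀ i, lor y (pd i (loc ψ p) (pt p)) = 0 := by
  intro i
  have hd : ContDiff ℝ ∞ (loc ψ p) := (h.1.comp (contMDiff_param p)).contDiff
  have hl : IsLocalMax (fun x => lor y (loc ψ p x)) (pt p) := by
    refine Filter.Eventually.of_forall fun x => ?_
    simp only [loc_pt]
    exact hmax _
  have h2 : pd i (fun x => lor y (loc ψ p x)) (pt p) = 0 := by
    simp [pd, hl.fderiv_eq_zero]
  rw [pd_lor (differentiableAt_const y) (hd.diffAt _), pd_const] at h2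
  simpa using h2

theorem exists_forall_lor_le (h : IsSpacelikeImmersion ψ) (y : L4) :
    ∃ p, ∀ q, lor y (ψ q) ≤ lor y (ψ p) := by
  have hl : Continuous fun z : L4 => lor y z :=
    (contDiff_const.lor contDiff_id : ContDiff ℝ 0 fun z : L4 => lor y z).continuous
  have : Nonempty Sph := (NormedSpace.sphere_nonempty (x := (0 : EuclideanSpace ℝ (Fin 3)))
    (r := 1)).2 zero_le_one |>.to_subtype
  obtain ⟨p, -, hp⟩ := isCompact_univ.exists_isMaxOn (Set.univ_nonempty (α := Sph))
    (hl.comp h.1.continuous).continuousOn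
  exact ⟨p, fun q => hp (Set.mem_univ q)⟩

/-- Compactness forces the principal curvature of the conjugate null normal to be negative. -/
theorem principalCurvature_neg (h : IsSpacelikeImmersion ψ) (hc : ∀ p, ψ p ∈ futureCone) {c : ℝ}
    (hA : ∀ p, shapeOp ψ p (etaField ψ p) = c • (1 : Matrix (Fin 2) (Fin 2) ℝ)) : c < 0 := by
  -- A maximum of the time component, since `⟨-∂₀, z⟩ = z 0`.
  obtain ⟨p, hp⟩ := exists_forall_lor_le h (-e0)
  have hneg : ∀ z, lor (-e0) z = z 0 := fun z => by simp [lor, e0]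
  have hn := lor_pd_loc_eq_zero_of_forall_le h hp
  simp only [hneg] at hp
  obtain ⟨q, hq⟩ := exists_lor_ne_zero h hc p
  have hq' : lor (ψ p) (ψ q) < 0 := lt_of_le_of_ne (lor_nonpos_of_futureCone (hc p) (hc q)) hq
  have hfr := isNullFrame_etaField h hc p
  have hm := (hc p).2
  have hη : etaField ψ p = (1 / (2 * ψ p 0 ^ 2)) • ψ p + (1 / ψ p 0) • (-e0) := by
    symm
    apply hfr.unique
    · intro i
      rw [lor_add_left, lor_smul_left, lor_smul_left, hn, hfr.Ft]
      simp
    · simp only [lor_add_left, lor_add_right, lor_smul_left, lor_smul_right, hfr.FF,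
        lor_comm (ψ p) (-e0), hneg]
      simp only [e0, Pi.neg_apply, Matrix.cons_val_zero]
      field_simp
      ring
    · simp only [lor_add_right, lor_smul_right, hfr.FF, lor_comm (ψ p) (-e0), hneg]
      field_simp
      ring
  have hw := congrArg (fun w => lor w (ψ q)) (smul_add_etaField_const h hc hA p q)
  have hfq := isNullFrame_etaField h hc q
  simp only [hη, lor_add_left, lor_smul_left, hneg, hfq.FF, lor_comm (etaField ψ q), hfq.FE] at hw
  have hle : ψ q 0 / ψ p 0 ≤ 1 := (div_le_one hm).2 (hp q)
  have hpos : 0 < 1 / (2 * ψ p 0 ^ 2) := by positivity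
  -- The right side is nonnegative by maximality and `⟨ψ p, ψ q⟩ < 0`, so `c ≤ -1 / (2 (ψ p 0)²)`.
  have heq : (c + 1 / (2 * ψ p 0 ^ 2)) * lor (ψ p) (ψ q) = 1 - ψ q 0 / ψ p 0 := by
    linear_combination hw
  by_contra! hc0
  nlinarith

/-- A totally umbilical sphere in the cone exhausts the plane section containing it. -/
theorem S2_subset_range (h : IsSpacelikeImmersion ψ) (hc : ∀ p, ψ p ∈ futureCone) {c : ℝ}
    (hc0 : c < 0) {w : L4} (hw : ∀ p, c • ψ p + etaField ψ p = w) {y : L4} (hy : y ∈ futureCone)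
    (hwy : lor w y = 1) : y ∈ Set.range ψ := by
  obtain ⟨p, hp⟩ := exists_forall_lor_le h y
  have hn := lor_pd_loc_eq_zero_of_forall_le h hp
  have hfr := isNullFrame_etaField h hc p
  have hdec := hfr.normal_eq hn
  set a := lor y (etaField ψ p)
  set b := lor y (ψ p)
  have hab : a * b = 0 := by
    have := hy.1
    rw [hdec] at this
    simp only [lor_add_left, lor_add_right, lor_smul_left, lor_smul_right, hfr.FF, hfr.EE,
      lor_comm (etaField ψ p) (ψ p), hfr.FE] at this
    linarith
  have hab1 : c * b + a = 1 := by
    have := hwy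
    rw [← hw p, lor_add_left, lor_smul_left, lor_comm, lor_comm (etaField ψ p)] at this
    exact this
  -- If `a = 0` then `c b = 1`, so `b < 0`; maximality gives `⟨η p, ψ q⟩ ≥ 1`, and `⟨w, ψ q⟩ = 1`
  -- then forces `⟨ψ p, ψ q⟩ ≥ 0`. If `b = 0` then `a = 1` and `y = ψ p`.
  rcases mul_eq_zero.1 hab with ha | hb0
  · exfalso
    obtain ⟨q, hq⟩ := exists_lor_ne_zero h hc p
    apply hq
    refine le_antisymm (lor_nonpos_of_futureCone (hc p) (hc q)) ?_
    have hfq := isNullFrame_etaField h hc q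
    have h1 : lor w (ψ q) = 1 := by
      rw [← hw q, lor_add_left, lor_smul_left, hfq.FF, lor_comm, hfq.FE]
      simp
    have hyq : lor y (ψ q) = b * lor (etaField ψ p) (ψ q) := by
      conv_lhs => rw [hdec, ha]
      simp
    rw [← hw p, lor_add_left, lor_smul_left] at h1
    rw [ha, add_zero] at hab1
    have hle := hp q
    rw [hyq] at hle
    have hbneg : b < 0 := by nlinarith
    have : 1 ≤ lor (etaField ψ p) (ψ q) := by nlinarith
    nlinarith
  · rw [hb0] at hab1
    refine ⟨p, ?_⟩
    rw [hdec, hb0, show a = 1 by linarith]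
    simp

end Umbilical

end LightCone

end

/-! ### The characterisation theorem -/

open LightCone in
theorem mainTheorem9 :
    (∀ (u : L4) (r : ℝ), lor u u = -1 → u 0 < 0 → 0 < r →
      S2 u r ⊆ futureCone ∧
      (∀ x : Sph, 0 < lor u (stdEmb x)) ∧
      IsSpacelikeImmersion (roundParam u r) ∧
      Topology.IsEmbedding (roundParam u r) ∧
      Set.range (roundParam u r) = S2 u r ∧
      IsConjugateNullNormal (roundParam u r) (etaField (roundParam u r)) ∧
      (∀ p : Sph, shapeOp (roundParam u r) p (etaField (roundParam u r) p) =
        (-(1 / (2 * r ^ 2))) • (1 : Matrix (Fin 2) (Fin 2) ℝ)) ∧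
      (∀ p : Sph, gaussCurvature (roundParam u r) p = 1 / r ^ 2) ∧
      IsTotallyUmbilical (roundParam u r)) ∧
    (∀ ψ : Sph → L4, IsSpacelikeImmersion ψ → (∀ p, ψ p ∈ futureCone) → IsTotallyUmbilical ψ →
      IsConjugateNullNormal ψ (etaField ψ) ∧
      ∃ r : ℝ, 0 < r ∧
        (∀ p, gaussCurvature ψ p = 1 / r ^ 2) ∧
        (∀ p, shapeOp ψ p (etaField ψ p) =
          (-(1 / (2 * r ^ 2))) • (1 : Matrix (Fin 2) (Fin 2) ℝ)) ∧
        ∃ w : L4, lor w w < 0 ∧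
          (∀ p, (-(1 / (2 * r ^ 2))) • ψ p + etaField ψ p = w) ∧
          lor (r • w) (r • w) = -1 ∧ (r • w) 0 < 0 ∧
          Set.range ψ = S2 (r • w) r) := by
  refine ⟨fun u r hu hu0 hr => ?_, fun ψ h hc humb => ?_⟩
  · have h := isSpacelikeImmersion_roundParam hu hu0 hr
    have hS := roundParam_mem_S2 hu hu0 hr
    have hc := fun p => S2_subset_futureCone hu hu0 hr (hS p)
    have hA := shapeOp_of_section h hc hu hr fun p => (hS p).2
    refine ⟨S2_subset_futureCone hu hu0 hr, lor_stdEmb_pos hu hu0, h,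
      isEmbedding_roundParam hu hu0 hr, range_roundParam hu hu0 hr,
      isConjugateNullNormal_etaField h hc, hA, fun p => ?_,
      isTotallyUmbilical_of_shapeOp h hc fun p => ⟨_, hA p⟩⟩
    rw [gaussCurvature_eq h hc (hA p)]
    field_simp
  · have hη := isConjugateNullNormal_etaField h hc
    refine ⟨hη, ?_⟩
    choose c hAc using fun p => humb p (etaField ψ p) (hη p).1
    -- Only a base point is needed; the maximum property is discarded.
    obtain ⟨p₀, -⟩ := exists_forall_lor_le h 0
    have hA : ∀ p, shapeOp ψ p (etaField ψ p) = c p₀ • (1 : Matrix (Fin 2) (Fin 2) ℝ) := fun p => by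
      rw [hAc p, principalCurvature_const h hc hAc p p₀]
    have hneg := principalCurvature_neg h hc hA
    obtain ⟨r, hr, hcr⟩ : ∃ r : ℝ, 0 < r ∧ c p₀ = -(1 / (2 * r ^ 2)) := by
      -- The radius is dictated by `K = -2c = 1 / r²`.
      refine ⟨1 / √(-2 * c p₀), by have : 0 < -2 * c p₀ := by linarith
                                   positivity, ?_⟩
      rw [div_pow, Real.sq_sqrt (by linarith)]
      field_simp
    rw [hcr] at hA hneg
    have hw := fun p => smul_add_etaField_const h hc hA p p₀
    have hfr := isNullFrame_etaField h hc
    set w := (-(1 / (2 * r ^ 2))) • ψ p₀ + etaField ψ p₀ with hwdef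
    have hww : lor w w = -(1 / r ^ 2) := by
      simp only [hwdef, lor_add_left, lor_add_right, lor_smul_left, lor_smul_right, (hfr p₀).FF,
        (hfr p₀).EE, (hfr p₀).FE, lor_comm (etaField ψ p₀) (ψ p₀)]
      field_simp
      ring
    have hww0 : lor w w < 0 := by rw [hww, neg_lt_zero]; positivity
    have hwψ : ∀ p, lor w (ψ p) = 1 := fun p => by
      rw [← hw p, lor_add_left, lor_smul_left, (hfr p).FF, lor_comm, (hfr p).FE]
      simp
    have hw0 : w 0 < 0 := neg_of_lor_pos hww0 (hc p₀) (by rw [hwψ]; exact one_pos)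
    have huu : lor (r • w) (r • w) = -1 := by
      rw [lor_smul_left, lor_smul_right, hww]
      field_simp
    have hu0 : (r • w) 0 < 0 := mul_neg_of_pos_of_neg hr hw0
    refine ⟨r, hr, fun p => ?_, hA, w, hww0, hw, huu, hu0, ?_⟩
    · rw [gaussCurvature_eq h hc (hA p)]
      field_simp
    · apply Set.Subset.antisymm
      · rintro _ ⟨p, rfl⟩
        exact ⟨(hc p).1, by rw [lor_smul_left, hwψ, mul_one]⟩
      · intro y hy
        refine S2_subset_range h hc hneg hw (S2_subset_futureCone huu hu0 hr hy) ?_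
        have := hy.2
        rw [lor_smul_left] at this
        exact mul_left_cancel₀ hr.ne' (this.trans (mul_one r).symm)
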